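/- Let $N\in\mathbb N$. For a square matrix $u=(u_{ij})_{i,j=1,\dots,N}$ over a unital $C^*$-algebra, write $\alpha=a,a^*$, $\beta=b,b^*$, $\gamma=c,c^*$ for entries $a,b,c$ of $u$, and let the span of $a=u_{ij},b=u_{kl},c=u_{pq}$ be the pair $(\#\{i,k,p\},\#\{j,l,q\})$. Consider the universal $C^*$-algebras $C(O_N^+)$ and $C(U_N^+)$, generated by the entries of $u$ subject to $u_{ij}=u_{ij}^*$, $u^t=u^{-1}$, respectively to $u^*=u^{-1}$, $u^t=\bar u^{-1}$, and their quotients by the following further relations: - $O_N,U_N$: $\alpha\beta=\beta\alpha$ for all entries $a,b$; - $O_N^*,U_N^{**}$: $\alpha\beta\gamma=\gamma\beta\alpha$ for all entries $a,b,c$; - $\bar O_N,\bar U_N$: $\alpha\beta=-\beta\alpha$ if $a,b$ are distinct coordinates on the same row or on the same column of $u$, and $\alpha\beta=\beta\alpha$ otherwise; - $\bar O_N^*,\bar U_N^{**}$: $\alpha\beta\gamma=-\gamma\beta\alpha$ if the span of $a,b,c$ is $(\le 2,3)$ or $(3,\le 2)$, and $\alpha\beta\gamma=\gamma\beta\alpha$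 otherwise. Then: 1. These $10$ algebras have (unital $*$-homomorphic) Hopf algebra maps $\Delta(u_{ij})=\sum_k u_{ik}\otimes u_{kj}$ (into the spatial tensor product), $\varepsilon(u_{ij})=\delta_{ij}$, and $S(u_{ij})=u_{ji}^*$ (into the opposite algebra), and the corresponding quantum groups form the diagram $$\begin{array}{ccccccccc} U_N&\to&U_N^{**}&\to&U_N^+&\leftarrow&\bar U_N^{**}&\leftarrow&\bar U_N\\ \uparrow&&\uparrow&&\uparrow&&\uparrow&&\uparrow\\ O_N&\to&O_N^*&\to&O_N^+&\leftarrow&\bar O_N^*&\leftarrow&\bar O_N \end{array}$$ where each of the 13 arrows $H\to G$ is an inclusion of quantum groups, that is, a surjective unital $*$-homomorphism $C(G)\to C(H)$ mapping standard coordinates to standard coordinates and compatible with $\Delta,\varepsilon,S$. For $N\ge 3$ all these inclusions are proper, that is, none of these surjections is injective. 2. The quantum groups $O_N,U_N$ are the usual orthogonal and unitary groups: their algebras are the algebras of continuous functions on these groups, with $u_{ij}$ corresponding to the standard coordinates. 3. The classical version of a quantum group $G$ is the space of the characters $\chi:C(G)\to\mathbb C$, each viewed as the matrix $(\chi(u_{ij}))$.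 The classical versions of the quantum groups in the diagram are $$\begin{array}{ccccc} U_N&U_N&U_N&Y_N&K_N\\ O_N&O_N&O_N&X_N&H_N \end{array}$$ where $H_N=\mathbb Z_2\wr S_N$ and $K_N=\mathbb T\wr S_N$ are the groups of monomial matrices with nonzero entries in $\{\pm1\}$, respectively in $\mathbb T$, and where $X_N\subset O_N$, $Y_N\subset U_N$ consist of the matrices whose entries satisfy $abc=0$ whenever the span of $a,b,c$ is $(\le2,3)$ or $(3,\le2)$. -/

import Mathlib

open scoped Matrix TensorProduct ENNReal
open UniformSpace (Completion)

noncomputable section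

namespace LiberatedQG

/-! ### The defining relations of the ten quantum groups -/

/-- The two rows of the diagram: orthogonal quantum groups and unitary quantum groups. -/
inductive Row
  | real
  | complex

/-- The five columns of the diagram, from left to right. -/
inductive Column
  | classical
  | half
  | free
  | twistedHalf
  | twisted

/-- Labels of the ten quantum groups; for instance `⟨.real, .half⟩` is `O_N^*` and
`⟨.complex, .twistedHalf⟩` is the twist of `U_N^{**}`. -/
structure Label where
  row : Row
  col : Column

section Relations

variable {B : Type*} [Ring B] [StarRing B] {N : ℕ}

/-- The relations of `O_N^+` (self-adjoint entries, `uᵗ = u⁻¹`) and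
of `U_N^+` (`u^* = u⁻¹`, `uᵗ = ū⁻¹`). -/
def FreeRelations : Row → Matrix (Fin N) (Fin N) B → Prop
  | .real, u => u.map star = u ∧ uᵀ * u = 1 ∧ u * uᵀ = 1
  | .complex, u => (uᴴ * u = 1 ∧ u * uᴴ = 1) ∧ (uᵀ * u.map star = 1 ∧ u.map star * uᵀ = 1)

/-- The letter `α ∈ {a, a^*}` attached to the entry `a = u_{ij}`. -/
def letter (u : Matrix (Fin N) (Fin N) B) (e : Bool) (a : Fin N × Fin N) : B :=
  if e then star (u a.1 a.2) else u a.1 a.2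

/-- `a, b` are distinct positions on the same row or on the same column. -/
def Aligned (a b : Fin N × Fin N) : Prop :=
  a ≠ b ∧ (a.1 = b.1 ∨ a.2 = b.2)

/-- The number of rows spanned by three positions. -/
def rowSpan (a b c : Fin N × Fin N) : ℕ := ({a.1, b.1, c.1} : Finset (Fin N)).card

/-- The number of columns spanned by three positions. -/
def colSpan (a b c : Fin N × Fin N) : ℕ := ({a.2, b.2, c.2} : Finset (Fin N)).card

/-- The span of `a, b, c` is `(≤ 2, 3)` or `(3, ≤ 2)`. -/
def OddSpan (a b c : Fin N × Fin N) : Prop :=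
  (rowSpan a b c ≤ 2 ∧ colSpan a b c = 3) ∨ (rowSpan a b c = 3 ∧ colSpan a b c ≤ 2)

open Classical in
/-- The additional relations imposed in each column of the diagram, where `α, β, γ` stand for
arbitrary letters over the positions `a, b, c`. (For self-adjoint entries the letters `a` and
`a^*` coincide, so that these are the expected relations in the orthogonal case.) -/
def ColumnRelations (u : Matrix (Fin N) (Fin N) B) : Column → Prop
  | .classical => ∀ (e f : Bool) (a b : Fin N × Fin N),
      letter u e a * letter u f b = letter u f b * letter u e a
  | .half => ∀ (e f g : Bool) (a b c : Fin N × Fin N),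
      letter u e a * letter u f b * letter u g c = letter u g c * letter u f b * letter u e a
  | .free => True
  | .twistedHalf => ∀ (e f g : Bool) (a b c : Fin N × Fin N),
      letter u e a * letter u f b * letter u g c =
        if OddSpan a b c then -(letter u g c * letter u f b * letter u e a)
        else letter u g c * letter u f b * letter u e a
  | .twisted => ∀ (e f : Bool) (a b : Fin N × Fin N),
      letter u e a * letter u f b =
        if Aligned a b then -(letter u f b * letter u e a)
        else letter u f b * letter u e a

/-- All the defining relations of the quantum group labelled by `X`. -/
def Relations (X : Label) (u : Matrix (Fin N) (Fin N) B) : Prop :=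
  FreeRelations X.row u ∧ ColumnRelations u X.col

end Relations

/-! ### The universal C⋆-algebras -/

/-- Bounded families in a family of unital C⋆-algebras form a unital C⋆-algebra. -/
instance lpCStarAlgebra {I : Type*} (A : I → Type*) [∀ i, CStarAlgebra (A i)]
    [∀ i, Nontrivial (A i)] : CStarAlgebra (lp A ∞) where

/-- A square matrix over a (nonzero) unital C⋆-algebra, satisfying the relations of `X`. -/
structure Model (X : Label) (N : ℕ) where
  carrier : Type
  [cstar : CStarAlgebra carrier]
  [nontriv : Nontrivial carrier]
  u : Matrix (Fin N) (Fin N) carrier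
  rel : Relations X u

attribute [instance] Model.cstar Model.nontriv

/-- If the squares `x_k^* x_k` sum up to `1` then all the `x_k` have norm at most one. -/
theorem norm_le_one_of_sum {B : Type*} [CStarAlgebra B] [Nontrivial B] {ι : Type*} [Fintype ι]
    (x : ι → B) (h : ∑ k, star (x k) * x k = 1) (k : ι) : ‖x k‖ ≤ 1 := by
  let _ : PartialOrder B := CStarAlgebra.spectralOrder B
  have : StarOrderedRing B := CStarAlgebra.spectralOrderedRing B
  have h1 : star (x k) * x k ≤ 1 := by
    rw [← h]
    exact Finset.single_le_sum (f := fun k => star (x k) * x k)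
      (fun i _ => star_mul_self_nonneg (x i)) (Finset.mem_univ k)
  have h2 := CStarAlgebra.norm_le_norm_of_nonneg_of_le (star_mul_self_nonneg (x k)) h1
  rw [CStarRing.norm_star_mul_self, norm_one] at h2
  nlinarith [norm_nonneg (x k)]

theorem Model.norm_u_le {X : Label} {N : ℕ} (M : Model X N) (i j : Fin N) : ‖M.u i j‖ ≤ 1 := by
  have key : ∑ k, star (M.u k j) * M.u k j = 1 := by
    have h := M.rel.1
    rcases X with ⟨r, c⟩
    cases r with
    | real =>
      obtain ⟨h1, h2, -⟩ := h
      have := congrFun (congrFun h2 j) j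
      rw [Matrix.mul_apply, Matrix.one_apply_eq] at this
      rw [← this]
      refine Finset.sum_congr rfl fun k _ => ?_
      have h3 : star (M.u k j) = M.u k j := congrFun (congrFun h1 k) j
      rw [Matrix.transpose_apply, h3]
    | complex =>
      have := congrFun (congrFun h.1.1 j) j
      rwa [Matrix.mul_apply, Matrix.one_apply_eq] at this
  exact norm_le_one_of_sum (fun k => M.u k j) key i

/-- The universal matrix of coordinates: the family of all matrices satisfying the relations. -/
def universalCoord (X : Label) (N : ℕ) (i j : Fin N) : lp (fun M : Model X N => M.carrier) ∞ :=
  ⟨fun M => M.u i j, memℓp_infty ⟨1, by rintro _ ⟨M, rfl⟩; exact M.norm_u_le i j⟩⟩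

/-- The universal C⋆-algebra of the relations `X`, as the C⋆-algebra generated by the universal
coordinates; the norm is the supremum of the norms in all the models of the relations. -/
def universalSubalgebra (X : Label) (N : ℕ) :
    StarSubalgebra ℂ (lp (fun M : Model X N => M.carrier) ∞) :=
  (StarAlgebra.adjoin ℂ
    (Set.range fun p : Fin N × Fin N => universalCoord X N p.1 p.2)).topologicalClosure

instance (X : Label) (N : ℕ) : 
    IsClosed (universalSubalgebra X N : Set (lp (fun M : Model X N => M.carrier) ∞)) :=
  StarSubalgebra.isClosed_topologicalClosure _

/-- The algebra `C(G)` of the quantum group `G` labelled by `X`. -/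
def Fun (X : Label) (N : ℕ) : Type 1 := universalSubalgebra X N

instance (X : Label) (N : ℕ) : CStarAlgebra (Fun X N) :=
  inferInstanceAs (CStarAlgebra (universalSubalgebra X N))

/-- The standard coordinates `u_{ij} ∈ C(G)`. -/
def coord (X : Label) (N : ℕ) : Matrix (Fin N) (Fin N) (Fun X N) := fun i j =>
  ⟨universalCoord X N i j,
    StarSubalgebra.le_topologicalClosure _ (StarAlgebra.subset_adjoin ℂ _ ⟨(i, j), rfl⟩)⟩

/-- The representation of `C(G)` given by a model of the relations. -/
def Model.eval {X : Label} {N : ℕ} (M : Model X N) : Fun X N →⋆ₐ[ℂ] M.carrier where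
  toFun x := x.1 M
  map_one' := rfl
  map_mul' _ _ := rfl
  map_zero' := rfl
  map_add' _ _ := rfl
  commutes' _ := rfl
  map_star' _ := rfl

theorem Model.eval_coord {X : Label} {N : ℕ} (M : Model X N) (i j : Fin N) :
    M.eval (coord X N i j) = M.u i j := rfl

theorem fun_ext {X : Label} {N : ℕ} {x y : Fun X N} (h : ∀ M : Model X N, M.eval x = M.eval y) :
    x = y :=
  Subtype.ext (lp.ext (funext h))

theorem relations_coord (X : Label) (N : ℕ) : Relations X (coord X N) := by
  have hl : ∀ (M : Model X N) e a, M.eval (letter (coord X N) e a) = letter M.u e a := by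
    intro M e a
    cases e
    · rfl
    · exact map_star M.eval _
  constructor
  · have key : ∀ v w : Matrix (Fin N) (Fin N) (Fun X N),
        (∀ M : Model X N, v.map M.eval = w.map M.eval) → v = w := fun v w h =>
      Matrix.ext fun i j => fun_ext fun M => congrFun (congrFun (h M) i) j
    have hu : ∀ M : Model X N, (coord X N).map M.eval = M.u := fun M => rfl
    have hs : ∀ M : Model X N, ((coord X N).map star).map M.eval = M.u.map star := fun M => rfl
    have hm : ∀ (M : Model X N) (v w : Matrix (Fin N) (Fin N) (Fun X N)),
        (v * w).map M.eval = v.map M.eval * w.map M.eval := fun M v w =>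
      Matrix.map_mul (f := (M.eval : Fun X N →+* M.carrier))
    have h1 : ∀ M : Model X N, (1 : Matrix (Fin N) (Fin N) (Fun X N)).map M.eval = 1 := fun M =>
      Matrix.map_one _ (map_zero _) (map_one _)
    have ht : ∀ M : Model X N, (coord X N)ᵀ.map M.eval = M.uᵀ := fun M => rfl
    have hH : ∀ M : Model X N, (coord X N)ᴴ.map M.eval = M.uᴴ := fun M => rfl
    have hrel : ∀ M : Model X N, FreeRelations X.row M.u := fun M => M.rel.1
    rcases X with ⟨r, c⟩
    cases r with
    | real =>
      refine ⟨key _ _ fun M => ?_, key _ _ fun M => ?_, key _ _ fun M => ?_⟩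
      · rw [hs, hu]; exact (hrel M).1
      · rw [hm, ht, hu, h1]; exact (hrel M).2.1
      · rw [hm, ht, hu, h1]; exact (hrel M).2.2
    | complex =>
      refine ⟨⟨key _ _ fun M => ?_, key _ _ fun M => ?_⟩,
        ⟨key _ _ fun M => ?_, key _ _ fun M => ?_⟩⟩
      · rw [hm, hH, hu, h1]; exact (hrel M).1.1
      · rw [hm, hH, hu, h1]; exact (hrel M).1.2
      · rw [hm, ht, hs, h1]; exact (hrel M).2.1
      · rw [hm, ht, hs, h1]; exact (hrel M).2.2
  · have hrel : ∀ M : Model X N, ColumnRelations M.u X.col := fun M => M.rel.2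
    rcases X with ⟨r, c⟩
    cases c with
    | classical =>
      intro e f a b
      refine fun_ext fun M => ?_
      simpa only [map_mul, hl] using hrel M e f a b
    | half =>
      intro e f g a b c
      refine fun_ext fun M => ?_
      simpa only [map_mul, hl] using hrel M e f g a b c
    | free => trivial
    | twistedHalf =>
      intro e f g a b c
      refine fun_ext fun M => ?_
      simpa only [map_mul, map_neg, apply_ite M.eval, hl] using hrel M e f g a b c
    | twisted =>
      intro e f a b
      refine fun_ext fun M => ?_
      simpa only [map_mul, map_neg, apply_ite M.eval, hl] using hrel M e f a b

/-- The universal property of `C(G)`: its coordinates satisfy the relations, and the matrices over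
a C⋆-algebra which satisfy the relations correspond to the morphisms defined on `C(G)`. (Finitely
generated C⋆-algebras have at most continuum cardinality, so that it is enough to consider
C⋆-algebras in `Type`.) -/
theorem fun_universal (X : Label) (N : ℕ) :
    Relations X (coord X N) ∧
    ∀ (B : Type) [CStarAlgebra B] [Nontrivial B] (v : Matrix (Fin N) (Fin N) B), Relations X v →
      ∃! φ : Fun X N →⋆ₐ[ℂ] B, ∀ i j, φ (coord X N i j) = v i j := by
  refine ⟨relations_coord X N, fun B _ _ v hv => ⟨Model.eval ⟨B, v, hv⟩, fun _ _ => rfl, ?_⟩⟩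
  intro φ hφ
  have hc : ∀ ψ : Fun X N →⋆ₐ[ℂ] B, Continuous ψ := fun ψ =>
    AddMonoidHomClass.continuous_of_bound ψ 1 fun x => by
      simpa only [one_mul] using NonUnitalStarAlgHom.norm_apply_le ψ x
  refine StarAlgHom.ext_topologicalClosure (A := lp (fun M : Model X N => M.carrier) ∞)
    (S := StarAlgebra.adjoin ℂ
      (Set.range fun p : Fin N × Fin N => universalCoord X N p.1 p.2))
    (φ := φ) (ψ := Model.eval ⟨B, v, hv⟩)
    (hc φ) (hc _) ?_
  refine StarAlgHom.ext_adjoin ?_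
  rintro ⟨_, _⟩ ⟨p, rfl⟩
  exact hφ p.1 p.2

/-! ### The spatial tensor product -/

/-- A pair of (nonzero, unital) representations of `A` and `B` on Hilbert spaces. -/
structure RepPair (A B : Type*) [CStarAlgebra A] [CStarAlgebra B] where
  H : Type
  K : Type
  [normH : NormedAddCommGroup H]
  [innerH : InnerProductSpace ℂ H]
  [completeH : CompleteSpace H]
  [nontrivH : Nontrivial H]
  [normK : NormedAddCommGroup K]
  [innerK : InnerProductSpace ℂ K]
  [completeK : CompleteSpace K]
  [nontrivK : Nontrivial K]
  π : A →⋆ₐ[ℂ] (H →L[ℂ] H)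
  ρ : B →⋆ₐ[ℂ] (K →L[ℂ] K)

attribute [instance] RepPair.normH RepPair.innerH RepPair.completeH RepPair.nontrivH
  RepPair.normK RepPair.innerK RepPair.completeK RepPair.nontrivK

section Spatial

variable {A B : Type*} [CStarAlgebra A] [CStarAlgebra B]

/-- The Hilbert space tensor product `H ⊗ K`. -/
abbrev RepPair.HK (p : RepPair A B) : Type := Completion (p.H ⊗[ℂ] p.K)

instance (p : RepPair A B) : Nontrivial p.HK := by
  obtain ⟨x, hx⟩ := exists_ne (0 : p.H)
  obtain ⟨y, hy⟩ := exists_ne (0 : p.K)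
  refine ⟨⟨((x ⊗ₜ[ℂ] y : p.H ⊗[ℂ] p.K) : p.HK), 0, fun h => ?_⟩⟩
  have h1 := congrArg norm h
  rw [Completion.norm_coe, TensorProduct.norm_tmul, norm_zero] at h1
  rcases mul_eq_zero.1 h1 with h2 | h2
  · exact hx (norm_eq_zero.1 h2)
  · exact hy (norm_eq_zero.1 h2)

/-- The operator `π(a) ⊗ ρ(b)` on `H ⊗ K`. -/
def RepPair.op (p : RepPair A B) (a : A) (b : B) : p.HK →L[ℂ] p.HK :=
  (TensorProduct.mapL (p.π a) (p.ρ b)).completion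

instance (p : RepPair A B) : CStarAlgebra (p.HK →L[ℂ] p.HK) where

instance (p : RepPair A B) : Nontrivial (p.HK →L[ℂ] p.HK) :=
  ⟨⟨1, 0, fun h => by
    obtain ⟨x, hx⟩ := exists_ne (0 : p.HK)
    exact hx (by simpa using congrArg (fun T : p.HK →L[ℂ] p.HK => T x) h)⟩⟩

theorem RepPair.norm_op_le (p : RepPair A B) (a : A) (b : B) : ‖p.op a b‖ ≤ ‖a‖ * ‖b‖ := by
  have h1 : ‖p.op a b‖ ≤ ‖TensorProduct.mapL (p.π a) (p.ρ b)‖ := by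
    refine ContinuousLinearMap.opNorm_le_bound _ (ContinuousLinearMap.opNorm_nonneg _) fun x => ?_
    induction x using Completion.induction_on with
    | hp => exact isClosed_le (by fun_prop) (by fun_prop)
    | ih x =>
      rw [RepPair.op, ContinuousLinearMap.completion_apply_coe, Completion.norm_coe,
        Completion.norm_coe]
      exact ContinuousLinearMap.le_opNorm _ x
  refine h1.trans ((TensorProduct.norm_mapL_le _ _).trans ?_)
  exact mul_le_mul (NonUnitalStarAlgHom.norm_apply_le p.π a)
    (NonUnitalStarAlgHom.norm_apply_le p.ρ b) (norm_nonneg _) (norm_nonneg _)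

variable (A B) in
/-- The bounded families of operators indexed by all the pairs of representations. -/
abbrev BoundedOperators := lp (fun p : RepPair A B => p.HK →L[ℂ] p.HK) ∞

/-- The elementary tensor `a ⊗ b`, as the family of all the operators `π(a) ⊗ ρ(b)`. -/
def elementary (a : A) (b : B) : BoundedOperators A B :=
  ⟨fun p => p.op a b, memℓp_infty ⟨‖a‖ * ‖b‖, by rintro _ ⟨p, rfl⟩; exact p.norm_op_le a b⟩⟩

variable (A B) in
def spatialSubalgebra : StarSubalgebra ℂ (BoundedOperators A B) :=
  (StarAlgebra.adjoin ℂ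
    (Set.range fun p : A × B => elementary p.1 p.2)).topologicalClosure

instance : IsClosed (spatialSubalgebra A B : Set (BoundedOperators A B)) :=
  StarSubalgebra.isClosed_topologicalClosure _

variable (A B) in
/-- The spatial (minimal) tensor product of two C⋆-algebras: the completion of the algebraic
tensor product with respect to the norm `sup ‖(π ⊗ ρ)(x)‖`, over the representations `π, ρ` of
`A, B`. The Hilbert spaces are taken in `Type`, which is enough for separable `A, B`, because
these have faithful representations on separable Hilbert spaces. -/
def SpatialTensor : Type _ := spatialSubalgebra A B

instance : CStarAlgebra (SpatialTensor A B) :=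
  inferInstanceAs (CStarAlgebra (spatialSubalgebra A B))

/-- The elementary tensor `a ⊗ b` in the spatial tensor product. -/
def tmul (a : A) (b : B) : SpatialTensor A B :=
  ⟨elementary a b,
    StarSubalgebra.le_topologicalClosure _ (StarAlgebra.subset_adjoin ℂ _ ⟨(a, b), rfl⟩)⟩

end Spatial

/-! ### Quantum groups and their inclusions -/

/-- The Hopf algebra maps making the pair `(C(G), u)` a compact matrix quantum group:
the comultiplication `Δ(u_{ij}) = ∑_k u_{ik} ⊗ u_{kj}`, the counit `ε(u_{ij}) = δ_{ij}` and the
antipode `S(u_{ij}) = u_{ji}^*`, the latter being a morphism to the opposite algebra. -/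
structure HopfMaps (X : Label) (N : ℕ) where
  comul : Fun X N →⋆ₐ[ℂ] SpatialTensor (Fun X N) (Fun X N)
  comul_coord : ∀ i j, comul (coord X N i j) = ∑ k, tmul (coord X N i k) (coord X N k j)
  counit : Fun X N →⋆ₐ[ℂ] ℂ
  counit_coord : ∀ i j, counit (coord X N i j) = if i = j then 1 else 0
  antipode : Fun X N →⋆ₐ[ℂ] (Fun X N)ᵐᵒᵖ
  antipode_coord : ∀ i j, antipode (coord X N i j) = MulOpposite.op (star (coord X N j i))

/-- The morphism `p : C(G) → C(H)` exhibits `H` as a quantum subgroup of `G`: it is surjective,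
maps standard coordinates to standard coordinates, and is compatible with the comultiplications,
counits and antipodes. -/
structure IsInclusion {X Y : Label} {N : ℕ} (h : HopfMaps X N) (g : HopfMaps Y N)
    (p : Fun Y N →⋆ₐ[ℂ] Fun X N) : Prop where
  surjective : Function.Surjective p
  map_coord : ∀ i j, p (coord Y N i j) = coord X N i j
  map_comul : ∃ pp : SpatialTensor (Fun Y N) (Fun Y N) →⋆ₐ[ℂ] SpatialTensor (Fun X N) (Fun X N),
    (∀ a b, pp (tmul a b) = tmul (p a) (p b)) ∧ ∀ a, h.comul (p a) = pp (g.comul a)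
  map_counit : ∀ a, h.counit (p a) = g.counit a
  map_antipode : ∀ a, h.antipode (p a) = MulOpposite.op (p (g.antipode a).unop)

/-- The 13 arrows `X → Y` of the diagram: the 4 + 4 horizontal ones, pointing towards the free
quantum groups in the middle, and the 5 vertical ones. -/
inductive Arrow : Label → Label → Prop
  | classical_half (r : Row) : Arrow ⟨r, .classical⟩ ⟨r, .half⟩
  | half_free (r : Row) : Arrow ⟨r, .half⟩ ⟨r, .free⟩
  | twistedHalf_free (r : Row) : Arrow ⟨r, .twistedHalf⟩ ⟨r, .free⟩
  | twisted_twistedHalf (r : Row) : Arrow ⟨r, .twisted⟩ ⟨r, .twistedHalf⟩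
  | vertical (c : Column) : Arrow ⟨.real, c⟩ ⟨.complex, c⟩

/-! ### Classical versions -/

/-- The classical version of a quantum group: the space of characters `χ : C(G) → ℂ`,
each character being identified with the matrix `(χ(u_{ij}))`. -/
def classicalVersion (X : Label) (N : ℕ) : Set (Matrix (Fin N) (Fin N) ℂ) :=
  {M | ∃ χ : Fun X N →⋆ₐ[ℂ] ℂ, ∀ i j, χ (coord X N i j) = M i j}

/-- The orthogonal group `O_N` or the unitary group `U_N`, as a group of complex matrices. -/
def classicalGroup (N : ℕ) : Row → Set (Matrix (Fin N) (Fin N) ℂ)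
  | .real => (fun M : Matrix (Fin N) (Fin N) ℝ => M.map Complex.ofReal) ''
      (Matrix.orthogonalGroup (Fin N) ℝ : Set (Matrix (Fin N) (Fin N) ℝ))
  | .complex => (Matrix.unitaryGroup (Fin N) ℂ : Set (Matrix (Fin N) (Fin N) ℂ))

/-- The wreath products `H_N = ℤ₂ ≀ S_N` and `K_N = 𝕋 ≀ S_N`, as groups of monomial matrices with
nonzero entries in `{±1}`, respectively in the unit circle `𝕋`. -/
def monomialGroup (N : ℕ) : Row → Set (Matrix (Fin N) (Fin N) ℂ)
  | .real => {M | ∃ (σ : Equiv.Perm (Fin N)) (ε : Fin N → ℤˣ),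
      M = Matrix.of fun i j => if i = σ j then ((ε i : ℤ) : ℂ) else 0}
  | .complex => {M | ∃ (σ : Equiv.Perm (Fin N)) (z : Fin N → Circle),
      M = Matrix.of fun i j => if i = σ j then (z i : ℂ) else 0}

/-- The groups `X_N ⊂ O_N` and `Y_N ⊂ U_N` of the matrices whose entries satisfy `abc = 0` for all
positions `a, b, c` of span `(≤ 2, 3)` or `(3, ≤ 2)`. -/
def oddSpanGroup (N : ℕ) (r : Row) : Set (Matrix (Fin N) (Fin N) ℂ) :=
  {M | M ∈ classicalGroup N r ∧
    ∀ a b c : Fin N × Fin N, OddSpan a b c → M a.1 a.2 * M b.1 b.2 * M c.1 c.2 = 0}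

/-- The diagram of the classical versions. -/
def classicalTable (N : ℕ) (X : Label) : Set (Matrix (Fin N) (Fin N) ℂ) :=
  match X.col with
  | .classical | .half | .free => classicalGroup N X.row
  | .twistedHalf => oddSpanGroup N X.row
  | .twisted => monomialGroup N X.row

end LiberatedQG

end

noncomputable section

namespace LiberatedQG

/-! ### The relations as signed commutation relations -/

section Signed

variable {B : Type*} [Ring B] [StarRing B] {N : ℕ}

/-! All the column relations are commutation (`SignedPair`) or half-commutation (`SignedTriple`) up
to a sign that factors as one function of the row indices times the same function of the column
indices, with values ±1. For an aligned pair exactly one of the two factors is -1, and likewise for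
a triple of odd span. This factorization yields the Hopf structure: in a product of two matrices
with commuting entries the signs of the middle indices occur twice and cancel, giving Δ, while
transposition merely swaps the two factors, giving S over the opposite algebra. The counit comes
from the identity matrix.

The algebras `Fun X N` are not themselves small models, so maps into them, their opposites and their
tensor squares come from `exists_lift`: given a separating family of small representations of the
target, one maps into bounded families and checks that the image stays in the closed copy of the
target. Morphisms are then determined by coordinates (`fun_hom_ext`), so every compatibility is a
check on generators. Surjectivity uses that star-morphisms have closed range.

The horizontal arrows out of the pair columns exist because abc becomes cba by three transpositions,
and the triple sign is the product of the three pair signs. For properness, an injective arrow would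
force every model of the larger quantum group to satisfy the relations of the smaller one. Diagonal
matrices refute this: the signs are squares on the diagonal, so the twisted and untwisted cases
share the same examples.

A character is a complex matrix satisfying the relations, and over ℂ anticommutation means vanishing
of the product, which gives the classical table. For `O_N` and `U_N` the algebra is commutative, so
Gelfand theory gives injectivity of the map to continuous functions and Stone–Weierstrass gives
surjectivity. -/

/-- Commutation of the letters up to a sign which is multiplicative over rows and columns. -/
def SignedPair (s : Fin N → Fin N → ℤ) (u : Matrix (Fin N) (Fin N) B) : Prop :=
  ∀ (e f : Bool) (a b : Fin N × Fin N),
    letter u e a * letter u f b = (s a.1 b.1 * s a.2 b.2) • (letter u f b * letter u e a)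

/-- Half-commutation of the letters up to a sign which is multiplicative over rows and columns. -/
def SignedTriple (s : Fin N → Fin N → Fin N → ℤ) (u : Matrix (Fin N) (Fin N) B) : Prop :=
  ∀ (e f g : Bool) (a b c : Fin N × Fin N),
    letter u e a * letter u f b * letter u g c =
      (s a.1 b.1 c.1 * s a.2 b.2 c.2) • (letter u g c * letter u f b * letter u e a)

/-- The sign of a pair of indices: positive if and only if they coincide. -/
def pairSign (i j : Fin N) : ℤ := if i = j then 1 else -1

/-- The sign of a triple of indices: negative if and only if they are pairwise distinct. -/
def tripleSign (i j k : Fin N) : ℤ := if ({i, j, k} : Finset (Fin N)).card = 3 then -1 else 1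

theorem pairSign_mul_self (i j : Fin N) : pairSign i j * pairSign i j = 1 := by
  unfold pairSign; split_ifs <;> norm_num

theorem tripleSign_mul_self (i j k : Fin N) : tripleSign i j k * tripleSign i j k = 1 := by
  unfold tripleSign; split_ifs <;> norm_num

open Classical in
theorem pairSign_mul_pairSign (a b : Fin N × Fin N) :
    pairSign a.1 b.1 * pairSign a.2 b.2 = if Aligned a b then -1 else 1 := by
  unfold pairSign Aligned
  rcases a with ⟨i, j⟩
  rcases b with ⟨k, l⟩
  by_cases h : i = k <;> by_cases h' : j = l <;> simp [h, h']

-- Each span is at most 3, so the product of signs is negative precisely when one span equals 3 and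
-- the other does not.
open Classical in
theorem tripleSign_mul_tripleSign (a b c : Fin N × Fin N) :
    tripleSign a.1 b.1 c.1 * tripleSign a.2 b.2 c.2 = if OddSpan a b c then -1 else 1 := by
  have h1 : rowSpan a b c ≤ 3 := Finset.card_le_three
  have h2 : colSpan a b c ≤ 3 := Finset.card_le_three
  unfold tripleSign OddSpan
  change (if rowSpan a b c = 3 then (-1 : ℤ) else 1) * (if colSpan a b c = 3 then (-1 : ℤ) else 1)
    = _
  by_cases h : rowSpan a b c = 3 <;> by_cases h' : colSpan a b c = 3 <;>
    simp [h, h'] <;> omega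

theorem columnRelations_classical_iff (u : Matrix (Fin N) (Fin N) B) :
    ColumnRelations u .classical ↔ SignedPair (fun _ _ => 1) u := by
  simp [ColumnRelations, SignedPair]

theorem columnRelations_half_iff (u : Matrix (Fin N) (Fin N) B) :
    ColumnRelations u .half ↔ SignedTriple (fun _ _ _ => 1) u := by
  simp [ColumnRelations, SignedTriple]

theorem columnRelations_twisted_iff (u : Matrix (Fin N) (Fin N) B) :
    ColumnRelations u .twisted ↔ SignedPair pairSign u := by
  simp [ColumnRelations, SignedPair, pairSign_mul_pairSign, ite_smul]

theorem columnRelations_twistedHalf_iff (u : Matrix (Fin N) (Fin N) B) :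
    ColumnRelations u .twistedHalf ↔ SignedTriple tripleSign u := by
  simp [ColumnRelations, SignedTriple, tripleSign_mul_tripleSign, ite_smul]

/-- A property of matrices which holds for all signed commutation relations holds for
all column relations. -/
theorem ColumnRelations.imp {C : Type*} [Ring C] [StarRing C]
    {u : Matrix (Fin N) (Fin N) B} {v : Matrix (Fin N) (Fin N) C}
    (h2 : ∀ s : Fin N → Fin N → ℤ, (∀ i j, s i j * s i j = 1) → SignedPair s u → SignedPair s v)
    (h3 : ∀ s : Fin N → Fin N → Fin N → ℤ, (∀ i j k, s i j k * s i j k = 1) →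
      SignedTriple s u → SignedTriple s v)
    (c : Column) (h : ColumnRelations u c) : ColumnRelations v c := by
  cases c with
  | classical =>
    rw [columnRelations_classical_iff] at h ⊢
    exact h2 _ (fun _ _ => by norm_num) h
  | half =>
    rw [columnRelations_half_iff] at h ⊢
    exact h3 _ (fun _ _ _ => by norm_num) h
  | free => trivial
  | twistedHalf =>
    rw [columnRelations_twistedHalf_iff] at h ⊢
    exact h3 _ tripleSign_mul_self h
  | twisted =>
    rw [columnRelations_twisted_iff] at h ⊢
    exact h2 _ pairSign_mul_self h

theorem letter_of_map_star {u : Matrix (Fin N) (Fin N) B} (h : u.map star = u) (e : Bool)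
    (a : Fin N × Fin N) : letter u e a = u a.1 a.2 := by
  cases e
  · rfl
  · exact congrFun (congrFun h a.1) a.2

/-! ### Orthogonal matrices as unitary matrices -/

theorem FreeRelations.complex_of_real {u : Matrix (Fin N) (Fin N) B}
    (h : FreeRelations .real u) : FreeRelations .complex u := by
  obtain ⟨h1, h2, h3⟩ := h
  have h4 : uᴴ = uᵀ := by
    rw [← h1]
    exact Matrix.ext fun i j => by
      simpa using (congrFun (congrFun h1 j) i).symm
  refine ⟨⟨?_, ?_⟩, ?_, ?_⟩
  · rw [h4, h2]
  · rw [h4, h3]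
  · rw [h1, h2]
  · rw [h1, h3]

/-! ### Functoriality of the relations -/

section Map

variable {C : Type*} [Ring C] [StarRing C] [Algebra ℂ B] [Algebra ℂ C]

theorem letter_map (f : B →⋆ₐ[ℂ] C) (u : Matrix (Fin N) (Fin N) B) (e : Bool)
    (a : Fin N × Fin N) : letter (u.map f) e a = f (letter u e a) := by
  cases e
  · rfl
  · exact (map_star f _).symm

theorem map_map_star (f : B →⋆ₐ[ℂ] C) (u : Matrix (Fin N) (Fin N) B) :
    (u.map f).map star = (u.map star).map f :=
  Matrix.ext fun _ _ => (map_star f _).symm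

theorem map_matrix_mul (f : B →⋆ₐ[ℂ] C) (u v : Matrix (Fin N) (Fin N) B) :
    u.map f * v.map f = (u * v).map f :=
  (Matrix.map_mul (f := (f : B →+* C))).symm

theorem map_matrix_one (f : B →⋆ₐ[ℂ] C) : (1 : Matrix (Fin N) (Fin N) B).map f = 1 :=
  Matrix.map_one _ (map_zero f) (map_one f)

theorem FreeRelations.map (f : B →⋆ₐ[ℂ] C) {u : Matrix (Fin N) (Fin N) B} {r : Row}
    (h : FreeRelations r u) : FreeRelations r (u.map f) := by
  cases r with
  | real =>
    obtain ⟨h1, h2, h3⟩ := h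
    refine ⟨?_, ?_, ?_⟩
    · rw [map_map_star, h1]
    · rw [← Matrix.transpose_map, map_matrix_mul, h2, map_matrix_one]
    · rw [← Matrix.transpose_map, map_matrix_mul, h3, map_matrix_one]
  | complex =>
    obtain ⟨⟨h1, h2⟩, h3, h4⟩ := h
    have hH : (u.map f)ᴴ = uᴴ.map f := Matrix.ext fun _ _ => (map_star f _).symm
    refine ⟨⟨?_, ?_⟩, ?_, ?_⟩
    · rw [hH, map_matrix_mul, h1, map_matrix_one]
    · rw [hH, map_matrix_mul, h2, map_matrix_one]
    · rw [← Matrix.transpose_map, map_map_star, map_matrix_mul, h3, map_matrix_one]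
    · rw [← Matrix.transpose_map, map_map_star, map_matrix_mul, h4, map_matrix_one]

/-- A jointly separating family detects matrix identities. It serves both for a single injective
morphism and for the point evaluations on an algebra of continuous functions. -/
theorem FreeRelations.of_map {I : Type*} {C : I → Type*} [∀ i, Ring (C i)] [∀ i, StarRing (C i)]
    [∀ i, Algebra ℂ (C i)] {f : ∀ i, B →⋆ₐ[ℂ] C i} (hf : ∀ x y, (∀ i, f i x = f i y) → x = y)
    {u : Matrix (Fin N) (Fin N) B} {r : Row} (h : ∀ i, FreeRelations r (u.map (f i))) :
    FreeRelations r u := by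
  have hm : ∀ {v w : Matrix (Fin N) (Fin N) B}, (∀ i, v.map (f i) = w.map (f i)) → v = w :=
    fun h => Matrix.ext fun j k => hf _ _ fun i => congrFun (congrFun (h i) j) k
  cases r with
  | real =>
    refine ⟨hm fun i => ?_, hm fun i => ?_, hm fun i => ?_⟩ <;> obtain ⟨h1, h2, h3⟩ := h i
    · rw [← map_map_star, h1]
    · rw [← map_matrix_mul, Matrix.transpose_map, h2, map_matrix_one]
    · rw [← map_matrix_mul, Matrix.transpose_map, h3, map_matrix_one]
  | complex =>
    have hH : ∀ i, (u.map (f i))ᴴ = uᴴ.map (f i) := fun i =>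
      Matrix.ext fun _ _ => (map_star (f i) _).symm
    refine ⟨⟨hm fun i => ?_, hm fun i => ?_⟩, hm fun i => ?_, hm fun i => ?_⟩ <;>
      obtain ⟨⟨h1, h2⟩, h3, h4⟩ := h i
    · rw [← map_matrix_mul, ← hH, h1, map_matrix_one]
    · rw [← map_matrix_mul, ← hH, h2, map_matrix_one]
    · rw [← map_matrix_mul, Matrix.transpose_map, ← map_map_star, h3, map_matrix_one]
    · rw [← map_matrix_mul, Matrix.transpose_map, ← map_map_star, h4, map_matrix_one]

theorem Relations.map (f : B →⋆ₐ[ℂ] C) {u : Matrix (Fin N) (Fin N) B} {X : Label}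
    (h : Relations X u) : Relations X (u.map f) := by
  refine ⟨h.1.map f, h.2.imp (fun s _ hs => ?_) (fun s _ hs => ?_)⟩
  · intro e g a b
    rw [letter_map, letter_map, ← map_mul, hs e g a b, map_zsmul, map_mul]
  · intro e g k a b c
    rw [letter_map, letter_map, letter_map, ← map_mul, ← map_mul, hs e g k a b c, map_zsmul,
      map_mul, map_mul]

/-- Injective morphisms reflect the relations. -/
theorem Relations.of_map {f : B →⋆ₐ[ℂ] C} (hf : Function.Injective f)
    {u : Matrix (Fin N) (Fin N) B} {X : Label} (h : Relations X (u.map f)) : Relations X u := by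
  refine ⟨FreeRelations.of_map (f := fun _ : Unit => f) (fun _ _ h => hf (h ())) fun _ => h.1,
    h.2.imp (fun s _ hs => ?_) (fun s _ hs => ?_)⟩
  · intro e g a b
    apply hf
    simpa only [letter_map, map_mul, map_zsmul] using hs e g a b
  · intro e g k a b c
    apply hf
    simpa only [letter_map, map_mul, map_zsmul] using hs e g k a b c

end Map

/-! ### Products of commuting matrices -/

section Mul

theorem commute_letter {v w : Matrix (Fin N) (Fin N) B}
    (hc : ∀ i j k l, Commute (v i j) (w k l)) (hs : ∀ i j k l, Commute (v i j) (star (w k l)))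
    (e f : Bool) (a b : Fin N × Fin N) : Commute (letter v e a) (letter w f b) := by
  cases e <;> cases f
  · exact hc _ _ _ _
  · exact hs _ _ _ _
  · simpa [letter] using (hs a.1 a.2 b.1 b.2).star_star
  · exact (hc a.1 a.2 b.1 b.2).star_star

/-- The star reverses products; exchanging the commuting factors restores the order, so that a
starred entry expands in the same way as an unstarred one. -/
theorem letter_mul {v w : Matrix (Fin N) (Fin N) B}
    (hc : ∀ i j k l, Commute (v i j) (w k l)) (e : Bool) (a : Fin N × Fin N) :
    letter (v * w) e a = ∑ k, letter v e (a.1, k) * letter w e (k, a.2) := by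
  cases e
  · exact Matrix.mul_apply
  · simp only [letter, if_true, Matrix.mul_apply, star_sum]
    exact Finset.sum_congr rfl fun k _ => by rw [(hc _ _ _ _).eq, star_mul]

theorem map_star_mul {v w : Matrix (Fin N) (Fin N) B}
    (hc : ∀ i j k l, Commute (v i j) (w k l)) :
    (v * w).map star = v.map star * w.map star :=
  Matrix.ext fun i j => by
    simpa [letter, Matrix.mul_apply] using letter_mul hc true (i, j)

theorem transpose_mul_of_commute {R : Type*} [Ring R] {v w : Matrix (Fin N) (Fin N) R}
    (hc : ∀ i j k l, Commute (v i j) (w k l)) : (v * w)ᵀ = wᵀ * vᵀ :=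
  Matrix.ext fun i j => by
    simp only [Matrix.transpose_apply, Matrix.mul_apply]
    exact Finset.sum_congr rfl fun k _ => (hc _ _ _ _).eq

theorem mul_mul_mul_cancel_of_eq_one {R : Type*} [Ring R] {x y x' y' : R} (h : x * x' = 1)
    (h' : y * y' = 1) : (y * x) * (x' * y') = 1 := by
  rw [mul_assoc, ← mul_assoc x, h, one_mul, h']

theorem FreeRelations.mul {v w : Matrix (Fin N) (Fin N) B} {r : Row}
    (hc : ∀ i j k l, Commute (v i j) (w k l))
    (hv : FreeRelations r v) (hw : FreeRelations r w) : FreeRelations r (v * w) := by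
  cases r with
  | real =>
    obtain ⟨h1, h2, h3⟩ := hv
    obtain ⟨k1, k2, k3⟩ := hw
    refine ⟨?_, ?_, ?_⟩
    · rw [map_star_mul hc, h1, k1]
    · rw [transpose_mul_of_commute hc, mul_mul_mul_cancel_of_eq_one h2 k2]
    · rw [transpose_mul_of_commute hc, mul_mul_mul_cancel_of_eq_one k3 h3]
  | complex =>
    obtain ⟨⟨h1, h2⟩, h3, h4⟩ := hv
    obtain ⟨⟨k1, k2⟩, k3, k4⟩ := hw
    refine ⟨⟨?_, ?_⟩, ?_, ?_⟩
    · rw [Matrix.conjTranspose_mul, mul_mul_mul_cancel_of_eq_one h1 k1]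
    · rw [Matrix.conjTranspose_mul, mul_mul_mul_cancel_of_eq_one k2 h2]
    · rw [transpose_mul_of_commute hc, map_star_mul hc, mul_mul_mul_cancel_of_eq_one h3 k3]
    · rw [transpose_mul_of_commute hc, map_star_mul hc, mul_mul_mul_cancel_of_eq_one k4 h4]

/-- With middle indices x and y, exchanging the letters of v costs the row sign times s x y, and
exchanging those of w costs s x y times the column sign. The two copies of s x y cancel. -/
theorem SignedPair.mul {v w : Matrix (Fin N) (Fin N) B}
    (hc : ∀ i j k l, Commute (v i j) (w k l)) (hs : ∀ i j k l, Commute (v i j) (star (w k l)))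
    {s : Fin N → Fin N → ℤ} (hss : ∀ i j, s i j * s i j = 1)
    (hv : SignedPair s v) (hw : SignedPair s w) : SignedPair s (v * w) := by
  intro e f a b
  have hl := commute_letter hc hs
  simp only [letter_mul hc, Finset.sum_mul_sum, Finset.smul_sum]
  rw [Finset.sum_comm]
  refine Finset.sum_congr rfl fun y _ => Finset.sum_congr rfl fun x _ => ?_
  rw [(hl _ _ _ _).symm.mul_mul_mul_comm, (hl _ _ _ _).symm.mul_mul_mul_comm, hv, hw,
    smul_mul_smul_comm]
  congr 1
  linear_combination (s a.1 b.1 * s a.2 b.2) * hss x y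

theorem SignedTriple.mul {v w : Matrix (Fin N) (Fin N) B}
    (hc : ∀ i j k l, Commute (v i j) (w k l)) (hs : ∀ i j k l, Commute (v i j) (star (w k l)))
    {s : Fin N → Fin N → Fin N → ℤ} (hss : ∀ i j k, s i j k * s i j k = 1)
    (hv : SignedTriple s v) (hw : SignedTriple s w) : SignedTriple s (v * w) := by
  intro e f g a b c
  have hl := commute_letter hc hs
  have key : ∀ e f g (a b c : Fin N × Fin N),
      letter (v * w) e a * letter (v * w) f b * letter (v * w) g c =
        ∑ x, ∑ y, ∑ z, (letter v e (a.1, x) * letter v f (b.1, y) * letter v g (c.1, z)) *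
          (letter w e (x, a.2) * letter w f (y, b.2) * letter w g (z, c.2)) := by
    intro e f g a b c
    rw [letter_mul hc, letter_mul hc, letter_mul hc, Finset.sum_mul_sum, Finset.sum_mul]
    simp only [Finset.sum_mul_sum]
    refine Finset.sum_congr rfl fun x _ => Finset.sum_congr rfl fun y _ =>
      Finset.sum_congr rfl fun z _ => ?_
    rw [(hl _ _ _ _).symm.mul_mul_mul_comm,
      ((hl _ _ _ _).symm.mul_left (hl _ _ _ _).symm).mul_mul_mul_comm]
  rw [key, key, Finset.smul_sum]
  simp only [Finset.smul_sum]
  -- The reversed word sums over the middle indices in the opposite order.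
  have hr : ∀ F : Fin N → Fin N → Fin N → B,
      ∑ x, ∑ y, ∑ z, F x y z = ∑ z, ∑ y, ∑ x, F x y z := by
    intro F
    rw [Finset.sum_comm]
    simp_rw [fun y => Finset.sum_comm (s := Finset.univ) (t := Finset.univ) (f := fun x z => F x y z)]
    rw [Finset.sum_comm]
  rw [hr]
  refine Finset.sum_congr rfl fun z _ => Finset.sum_congr rfl fun y _ =>
    Finset.sum_congr rfl fun x _ => ?_
  rw [hv, hw, smul_mul_smul_comm]
  congr 1
  linear_combination (s a.1 b.1 c.1 * s a.2 b.2 c.2) * hss x y z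

/-- The relations are stable under products of matrices having commuting entries. -/
theorem Relations.mul {v w : Matrix (Fin N) (Fin N) B} {X : Label}
    (hc : ∀ i j k l, Commute (v i j) (w k l)) (hs : ∀ i j k l, Commute (v i j) (star (w k l)))
    (hv : Relations X v) (hw : Relations X w) : Relations X (v * w) := by
  refine ⟨hv.1.mul hc hw.1, ?_⟩
  have h1 := hv.2
  have h2 := hw.2
  cases h : X.col <;> rw [h] at h1 h2
  · rw [columnRelations_classical_iff] at *
    exact h1.mul hc hs (fun _ _ => by norm_num) h2
  · rw [columnRelations_half_iff] at *
    exact h1.mul hc hs (fun _ _ _ => by norm_num) h2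
  · trivial
  · rw [columnRelations_twistedHalf_iff] at *
    exact h1.mul hc hs tripleSign_mul_self h2
  · rw [columnRelations_twisted_iff] at *
    exact h1.mul hc hs pairSign_mul_self h2

end Mul

/-! ### The opposite matrix -/

section Opposite

/-- The matrix `u_{ji}^*` over the opposite algebra. -/
def oppositeMatrix (u : Matrix (Fin N) (Fin N) B) : Matrix (Fin N) (Fin N) Bᵐᵒᵖ :=
  Matrix.of fun i j => MulOpposite.op (star (u j i))

theorem letter_oppositeMatrix (u : Matrix (Fin N) (Fin N) B) (e : Bool) (a : Fin N × Fin N) :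
    letter (oppositeMatrix u) e a = MulOpposite.op (letter u (!e) a.swap) := by
  cases e <;> simp [letter, oppositeMatrix]

/-- Transposing and reversing products exchanges the relations for u with those for its entrywise
conjugate, and left inverses with right inverses. -/
theorem FreeRelations.opposite {u : Matrix (Fin N) (Fin N) B} {r : Row}
    (h : FreeRelations r u) : FreeRelations r (oppositeMatrix u) := by
  have e1 : ∀ i j, (1 : Matrix (Fin N) (Fin N) Bᵐᵒᵖ) i j =
      MulOpposite.op ((1 : Matrix (Fin N) (Fin N) B) j i) := by
    intro i j
    rcases eq_or_ne i j with rfl | h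
    · simp
    · simp [h, h.symm]
  cases r with
  | real =>
    obtain ⟨h1, h2, h3⟩ := h
    have hs : ∀ i j, star (u i j) = u i j := fun i j => congrFun (congrFun h1 i) j
    refine ⟨?_, ?_, ?_⟩
    · ext i j
      simp [oppositeMatrix, hs, ← MulOpposite.op_star]
    · ext i j
      rw [e1, ← h3]
      simp [oppositeMatrix, hs, Matrix.mul_apply]
    · ext i j
      rw [e1, ← h2]
      simp [oppositeMatrix, hs, Matrix.mul_apply]
  | complex =>
    obtain ⟨⟨h1, h2⟩, h3, h4⟩ := h
    refine ⟨⟨?_, ?_⟩, ?_, ?_⟩ <;> ext i j <;> rw [e1]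
    · rw [← h4]; simp [oppositeMatrix, Matrix.mul_apply]
    · rw [← h3]; simp [oppositeMatrix, Matrix.mul_apply]
    · rw [← h2]; simp [oppositeMatrix, Matrix.mul_apply]
    · rw [← h1]; simp [oppositeMatrix, Matrix.mul_apply]

/-- Over the opposite algebra each relation is read backwards, with row and column signs swapped;
since the total sign is its own inverse, this is the same relation. -/
theorem Relations.opposite {u : Matrix (Fin N) (Fin N) B} {X : Label}
    (h : Relations X u) : Relations X (oppositeMatrix u) := by
  refine ⟨h.1.opposite, h.2.imp (fun s hss hs => ?_) (fun s hss hs => ?_)⟩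
  · intro e f a b
    simp only [letter_oppositeMatrix, ← MulOpposite.op_mul, ← MulOpposite.op_smul]
    rw [hs (!e) (!f) a.swap b.swap, smul_smul]
    congr 1
    simp only [Prod.fst_swap, Prod.snd_swap]
    rw [show s a.1 b.1 * s a.2 b.2 * (s a.2 b.2 * s a.1 b.1) = 1 by
      linear_combination s a.1 b.1 * s a.1 b.1 * hss a.2 b.2 + hss a.1 b.1, one_smul]
  · intro e f g a b c
    simp only [letter_oppositeMatrix, ← MulOpposite.op_mul, ← MulOpposite.op_smul, ← mul_assoc]
    rw [hs (!e) (!f) (!g) a.swap b.swap c.swap, smul_smul]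
    congr 1
    simp only [Prod.fst_swap, Prod.snd_swap]
    rw [show s a.1 b.1 c.1 * s a.2 b.2 c.2 * (s a.2 b.2 c.2 * s a.1 b.1 c.1) = 1 by
      linear_combination s a.1 b.1 c.1 * s a.1 b.1 c.1 * hss a.2 b.2 c.2 + hss a.1 b.1 c.1,
      one_smul]

end Opposite

end Signed


/-! ### Morphisms defined on the universal algebras -/

/-- A family of morphisms of C⋆-algebras, as a morphism to the algebra of bounded families. -/
def lpHom {C : Type*} [CStarAlgebra C] {I : Type*} {A : I → Type*} [∀ i, CStarAlgebra (A i)]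
    [∀ i, Nontrivial (A i)] (θ : ∀ i, C →⋆ₐ[ℂ] A i) : C →⋆ₐ[ℂ] lp A ∞ where
  toFun x := ⟨fun i => θ i x, memℓp_infty ⟨‖x‖, by
    rintro _ ⟨i, rfl⟩; exact NonUnitalStarAlgHom.norm_apply_le (θ i) x⟩⟩
  map_one' := Subtype.ext (funext fun i => map_one (θ i))
  map_mul' x y := Subtype.ext (funext fun i => map_mul (θ i) x y)
  map_zero' := Subtype.ext (funext fun i => map_zero (θ i))
  map_add' x y := Subtype.ext (funext fun i => map_add (θ i) x y)
  commutes' z := Subtype.ext (funext fun i => AlgHomClass.commutes (θ i) z)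
  map_star' x := Subtype.ext (funext fun i => map_star (θ i) x)

theorem continuous_starAlgHom {C D : Type*} [CStarAlgebra C] [CStarAlgebra D]
    (φ : C →⋆ₐ[ℂ] D) : Continuous φ :=
  AddMonoidHomClass.continuous_of_bound φ 1 fun x => by
    simpa only [one_mul] using NonUnitalStarAlgHom.norm_apply_le φ x

theorem isClosed_range_of_injective {C D : Type*} [CStarAlgebra C] [CStarAlgebra D]
    (φ : C →⋆ₐ[ℂ] D) (hφ : Function.Injective φ) : IsClosed (Set.range φ) :=
  (NonUnitalStarAlgHom.isometry φ hφ).isClosedEmbedding.isClosed_range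

/-- A closed subalgebra of the closure has closed image in the ambient algebra, so minimality of the
closure applies to that image. -/
theorem eq_top_of_isClosed_of_subset {A : Type*} [CStarAlgebra A] {G : Set A}
    (S : StarSubalgebra ℂ ↥(StarAlgebra.adjoin ℂ G).topologicalClosure)
    (hS : IsClosed (S : Set ↥(StarAlgebra.adjoin ℂ G).topologicalClosure))
    (hG : ∀ x : ↥(StarAlgebra.adjoin ℂ G).topologicalClosure, (x : A) ∈ G → x ∈ S) : S = ⊤ := by
  have h1 : (StarAlgebra.adjoin ℂ G).topologicalClosure ≤
      S.map (StarAlgebra.adjoin ℂ G).topologicalClosure.subtype := by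
    refine StarSubalgebra.topologicalClosure_minimal ?_ ?_
    · rw [StarAlgebra.adjoin_le_iff]
      intro x hx
      exact ⟨⟨x, StarSubalgebra.le_topologicalClosure _ (StarAlgebra.subset_adjoin ℂ _ hx)⟩,
        hG _ hx, rfl⟩
    · have hc : IsClosed ((StarAlgebra.adjoin ℂ G).topologicalClosure : Set A) :=
        StarSubalgebra.isClosed_topologicalClosure _
      exact hc.isClosedEmbedding_subtypeVal.isClosedMap _ hS
  rw [eq_top_iff]
  rintro x -
  obtain ⟨y, hy, hyx⟩ := h1 x.2
  rwa [← Subtype.ext (a1 := y) (a2 := x) hyx]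

theorem fun_eq_top {X : Label} {N : ℕ} (S : StarSubalgebra ℂ (Fun X N))
    (hS : IsClosed (S : Set (Fun X N))) (hG : ∀ i j, coord X N i j ∈ S) : S = ⊤ := by
  refine eq_top_of_isClosed_of_subset (A := lp (fun M : Model X N => M.carrier) ∞)
    (G := Set.range fun p : Fin N × Fin N => universalCoord X N p.1 p.2) S hS ?_
  rintro ⟨_, hx⟩ ⟨p, rfl⟩
  exact hG p.1 p.2

theorem spatial_eq_top {A B : Type*} [CStarAlgebra A] [CStarAlgebra B]
    (S : StarSubalgebra ℂ (SpatialTensor A B))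
    (hS : IsClosed (S : Set (SpatialTensor A B))) (hG : ∀ a b, tmul a b ∈ S) : S = ⊤ := by
  refine eq_top_of_isClosed_of_subset (A := BoundedOperators A B)
    (G := Set.range fun p : A × B => elementary p.1 p.2) S hS ?_
  rintro ⟨_, hx⟩ ⟨p, rfl⟩
  exact hG p.1 p.2

/-- A morphism defined on `C(G)` is determined by the images of the standard coordinates. -/
theorem fun_hom_ext {X : Label} {N : ℕ} {B : Type*} [CStarAlgebra B] {φ ψ : Fun X N →⋆ₐ[ℂ] B}
    (h : ∀ i j, φ (coord X N i j) = ψ (coord X N i j)) : φ = ψ := by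
  have h1 := fun_eq_top (StarAlgHom.equalizer φ ψ)
    (isClosed_eq (continuous_starAlgHom φ) (continuous_starAlgHom ψ)) h
  refine StarAlgHom.ext fun x => ?_
  have h2 : x ∈ StarAlgHom.equalizer φ ψ := h1 ▸ StarSubalgebra.mem_top
  exact h2

/-- A morphism into bounded families, whose values on generators come from an algebra embedded
into the bounded families, factors through that algebra. -/
theorem exists_factor {C B D : Type*} [CStarAlgebra C] [CStarAlgebra B] [CStarAlgebra D]
    (T : C →⋆ₐ[ℂ] D) (J : B →⋆ₐ[ℂ] D) (hJ : Function.Injective J)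
    (h : ∀ x, T x ∈ Set.range J) :
    ∃ φ : C →⋆ₐ[ℂ] B, ∀ x, J (φ x) = T x := by
  choose φ hφ using h
  refine ⟨⟨⟨⟨⟨⟨φ, ?_⟩, ?_⟩, ?_, ?_⟩, ?_⟩, ?_⟩, hφ⟩
  · exact hJ (by rw [hφ, map_one, map_one])
  · exact fun x y => hJ (by simp only [hφ, map_mul])
  · exact hJ (by simp only [hφ, map_zero])
  · exact fun x y => hJ (by simp only [hφ, map_add])
  · exact fun z => hJ (by simp only [hφ, AlgHomClass.commutes])
  · exact fun x => hJ (by simp only [hφ, map_star])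

/-- The universal property of `C(G)` with respect to the C⋆-algebras in arbitrary universes
having a separating family of representations on small C⋆-algebras. -/
theorem exists_lift {X : Label} {N : ℕ} {B : Type*} [CStarAlgebra B] {I : Type*} (A : I → Type)
    [∀ i, CStarAlgebra (A i)] [∀ i, Nontrivial (A i)] (ψ : ∀ i, B →⋆ₐ[ℂ] A i)
    (hψ : ∀ x y, (∀ i, ψ i x = ψ i y) → x = y) (v : Matrix (Fin N) (Fin N) B)
    (hv : Relations X v) : ∃ φ : Fun X N →⋆ₐ[ℂ] B, ∀ i j, φ (coord X N i j) = v i j := by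
  let T : Fun X N →⋆ₐ[ℂ] lp A ∞ := lpHom fun i => Model.eval ⟨A i, v.map (ψ i), hv.map (ψ i)⟩
  have hJ : Function.Injective (lpHom ψ) := fun x y h =>
    hψ x y fun i => congrFun (congrArg Subtype.val h) i
  have hT : ∀ i j, T (coord X N i j) = lpHom ψ (v i j) := fun i j => rfl
  -- The elements sent by `T` into the copy of `B` form a closed star-subalgebra containing the
  -- coordinates, hence everything.
  have hS := fun_eq_top (((lpHom ψ).range).comap T)
    ((isClosed_range_of_injective _ hJ).preimage (continuous_starAlgHom T))
    fun i j => ⟨v i j, (hT i j).symm⟩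
  obtain ⟨φ, hφ⟩ := exists_factor T (lpHom ψ) hJ fun x => by
    have : x ∈ ((lpHom ψ).range).comap T := hS ▸ StarSubalgebra.mem_top
    exact this
  exact ⟨φ, fun i j => hJ ((hφ _).trans (hT i j))⟩

theorem exists_lift_small {X : Label} {N : ℕ} {B : Type} [CStarAlgebra B] [Nontrivial B]
    {v : Matrix (Fin N) (Fin N) B} (hv : Relations X v) :
    ∃ φ : Fun X N →⋆ₐ[ℂ] B, ∀ i j, φ (coord X N i j) = v i j :=
  ⟨Model.eval ⟨B, v, hv⟩, fun _ _ => rfl⟩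

theorem exists_lift_fun {X Y : Label} {N : ℕ} {v : Matrix (Fin N) (Fin N) (Fun Y N)}
    (hv : Relations X v) : ∃ φ : Fun X N →⋆ₐ[ℂ] Fun Y N, ∀ i j, φ (coord X N i j) = v i j :=
  exists_lift (fun M : Model Y N => M.carrier) Model.eval (fun _ _ => fun_ext) v hv

/-- The morphism induced between the opposite algebras. -/
def opHom {A B : Type*} [CStarAlgebra A] [CStarAlgebra B] (φ : A →⋆ₐ[ℂ] B) :
    Aᵐᵒᵖ →⋆ₐ[ℂ] Bᵐᵒᵖ where
  toFun x := MulOpposite.op (φ x.unop)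
  map_one' := by simp
  map_mul' x y := by simp
  map_zero' := by simp
  map_add' x y := by simp
  commutes' z := by simp [MulOpposite.algebraMap_apply, AlgHomClass.commutes]
  map_star' x := by simp [map_star]

/-- The opposites of the small models separate the points of the opposite algebra. -/
theorem exists_antipode (X : Label) (N : ℕ) : ∃ S : Fun X N →⋆ₐ[ℂ] (Fun X N)ᵐᵒᵖ,
    ∀ i j, S (coord X N i j) = MulOpposite.op (star (coord X N j i)) :=
  exists_lift (fun M : Model X N => M.carrierᵐᵒᵖ) (fun M => opHom M.eval)
    (fun _ _ h => MulOpposite.unop_injective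
      (fun_ext fun M => MulOpposite.op_injective (h M)))
    (oppositeMatrix (coord X N)) (relations_coord X N).opposite

/-! ### The spatial tensor product -/

section Spatial

variable {A B : Type*} [CStarAlgebra A] [CStarAlgebra B]

theorem RepPair.op_tmul (p : RepPair A B) (a : A) (b : B) (x : p.H) (y : p.K) :
    p.op a b ((x ⊗ₜ[ℂ] y : p.H ⊗[ℂ] p.K) : p.HK) =
      ((p.π a x ⊗ₜ[ℂ] p.ρ b y : p.H ⊗[ℂ] p.K) : p.HK) := by
  rw [RepPair.op, ContinuousLinearMap.completion_apply_coe]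
  rfl

/-- Elementary tensors span a dense subspace, so identities between bounded operators need only be
tested there. -/
theorem RepPair.ext_op (p : RepPair A B) {S T : p.HK →L[ℂ] p.HK}
    (h : ∀ (x : p.H) (y : p.K), S ((x ⊗ₜ[ℂ] y : p.H ⊗[ℂ] p.K) : p.HK) =
      T ((x ⊗ₜ[ℂ] y : p.H ⊗[ℂ] p.K) : p.HK)) : S = T := by
  ext z
  induction z using Completion.induction_on with
  | hp => exact isClosed_eq S.continuous T.continuous
  | ih z =>
    induction z using TensorProduct.induction_on with
    | zero => rw [Completion.coe_zero, map_zero, map_zero]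
    | tmul x y => exact h x y
    | add x y hx hy => rw [Completion.coe_add, map_add, map_add, hx, hy]

theorem RepPair.op_mul (p : RepPair A B) (a a' : A) (b b' : B) :
    p.op (a * a') (b * b') = p.op a b * p.op a' b' :=
  p.ext_op fun x y => by
    rw [mul_apply_eq_comp]
    simp only [p.op_tmul, map_mul, mul_apply_eq_comp]

theorem RepPair.op_one (p : RepPair A B) : p.op 1 1 = 1 :=
  p.ext_op fun x y => by
    simp only [p.op_tmul, map_one, one_apply_eq_self]

theorem RepPair.op_add_left (p : RepPair A B) (a a' : A) (b : B) :
    p.op (a + a') b = p.op a b + p.op a' b :=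
  p.ext_op fun x y => by
    simp only [p.op_tmul, map_add, add_apply, TensorProduct.add_tmul,
      Completion.coe_add]

theorem RepPair.op_add_right (p : RepPair A B) (a : A) (b b' : B) :
    p.op a (b + b') = p.op a b + p.op a b' :=
  p.ext_op fun x y => by
    simp only [p.op_tmul, map_add, add_apply, TensorProduct.tmul_add,
      Completion.coe_add]

theorem RepPair.op_smul_left (p : RepPair A B) (z : ℂ) (a : A) (b : B) :
    p.op (z • a) b = z • p.op a b :=
  p.ext_op fun x y => by
    simp only [p.op_tmul, map_smul, smul_apply, ← TensorProduct.smul_tmul',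
      Completion.coe_smul]

theorem RepPair.op_smul_right (p : RepPair A B) (z : ℂ) (a : A) (b : B) :
    p.op a (z • b) = z • p.op a b :=
  p.ext_op fun x y => by
    simp only [p.op_tmul, map_smul, smul_apply, TensorProduct.tmul_smul,
      Completion.coe_smul]

theorem RepPair.op_star (p : RepPair A B) (a : A) (b : B) :
    p.op (star a) (star b) = star (p.op a b) := by
  rw [ContinuousLinearMap.star_eq_adjoint, ContinuousLinearMap.eq_adjoint_iff]
  intro x y
  induction x using Completion.induction_on with
  | hp => exact isClosed_eq (by fun_prop) (by fun_prop)
  | ih x =>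
  induction y using Completion.induction_on with
  | hp => exact isClosed_eq (by fun_prop) (by fun_prop)
  | ih y =>
  induction x using TensorProduct.induction_on with
  | zero => simp only [Completion.coe_zero, map_zero, inner_zero_left]
  | add x x' hx hx' => simp only [Completion.coe_add, map_add, inner_add_left, hx, hx']
  | tmul x x' =>
  induction y using TensorProduct.induction_on with
  | zero => simp only [Completion.coe_zero, map_zero, inner_zero_right]
  | add y y' hy hy' => simp only [Completion.coe_add, map_add, inner_add_right, hy, hy']
  | tmul y y' =>
    rw [p.op_tmul, p.op_tmul, Completion.inner_coe, Completion.inner_coe,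
      TensorProduct.inner_tmul, TensorProduct.inner_tmul, map_star, map_star,
      ContinuousLinearMap.star_eq_adjoint, ContinuousLinearMap.star_eq_adjoint,
      ContinuousLinearMap.adjoint_inner_left, ContinuousLinearMap.adjoint_inner_left]

theorem spatial_ext {x y : SpatialTensor A B} (h : ∀ p : RepPair A B, x.1 p = y.1 p) : x = y :=
  Subtype.ext (lp.ext (funext h))

theorem tmul_mul_tmul (a a' : A) (b b' : B) :
    tmul a b * tmul a' b' = tmul (a * a') (b * b') :=
  spatial_ext fun p => (p.op_mul a a' b b').symm

theorem tmul_one_one : (tmul 1 1 : SpatialTensor A B) = 1 :=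
  spatial_ext fun p => p.op_one

theorem tmul_star (a : A) (b : B) : tmul (star a) (star b) = star (tmul a b) :=
  spatial_ext fun p => p.op_star a b

/-- The embedding `a ↦ a ⊗ 1`. -/
def inclLeft : A →⋆ₐ[ℂ] SpatialTensor A B where
  toFun a := tmul a 1
  map_one' := tmul_one_one
  map_mul' a a' := by rw [tmul_mul_tmul, mul_one]
  map_zero' := spatial_ext fun p => by
    have h := p.op_smul_left 0 0 1
    rw [zero_smul, zero_smul] at h
    exact h
  map_add' a a' := spatial_ext fun p => p.op_add_left a a' 1
  commutes' z := by
    rw [Algebra.algebraMap_eq_smul_one, Algebra.algebraMap_eq_smul_one, ← tmul_one_one]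
    exact spatial_ext fun p => p.op_smul_left z 1 1
  map_star' a := by rw [← tmul_star, star_one]

/-- The embedding `b ↦ 1 ⊗ b`. -/
def inclRight : B →⋆ₐ[ℂ] SpatialTensor A B where
  toFun b := tmul 1 b
  map_one' := tmul_one_one
  map_mul' b b' := by rw [tmul_mul_tmul, mul_one]
  map_zero' := spatial_ext fun p => by
    have h := p.op_smul_right 0 1 0
    rw [zero_smul, zero_smul] at h
    exact h
  map_add' b b' := spatial_ext fun p => p.op_add_right 1 b b'
  commutes' z := by
    rw [Algebra.algebraMap_eq_smul_one, Algebra.algebraMap_eq_smul_one, ← tmul_one_one]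
    exact spatial_ext fun p => p.op_smul_right z 1 1
  map_star' b := by rw [← tmul_star, star_one]

theorem inclLeft_mul_inclRight (a : A) (b : B) :
    (inclLeft a * inclRight b : SpatialTensor A B) = tmul a b := by
  change tmul a 1 * tmul 1 b = tmul a b
  rw [tmul_mul_tmul, mul_one, one_mul]

theorem commute_inclLeft_inclRight (a : A) (b : B) :
    Commute (inclLeft a : SpatialTensor A B) (inclRight b) := by
  change tmul a 1 * tmul 1 b = tmul 1 b * tmul a 1
  rw [tmul_mul_tmul, tmul_mul_tmul, mul_one, one_mul, mul_one, one_mul]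

/-- The representations of a spatial tensor product. -/
def spatialEval (p : RepPair A B) : SpatialTensor A B →⋆ₐ[ℂ] (p.HK →L[ℂ] p.HK) where
  toFun x := x.1 p
  map_one' := rfl
  map_mul' _ _ := rfl
  map_zero' := rfl
  map_add' _ _ := rfl
  commutes' _ := rfl
  map_star' _ := rfl

variable {A' B' : Type*} [CStarAlgebra A'] [CStarAlgebra B']

/-- The pullback of a pair of representations. -/
def RepPair.comp (p : RepPair A B) (φ : A' →⋆ₐ[ℂ] A) (ψ : B' →⋆ₐ[ℂ] B) : RepPair A' B' where
  H := p.H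
  K := p.K
  π := p.π.comp φ
  ρ := p.ρ.comp ψ

/-- Functoriality of the spatial tensor product. -/
theorem exists_spatialMap (φ : A' →⋆ₐ[ℂ] A) (ψ : B' →⋆ₐ[ℂ] B) :
    ∃ φψ : SpatialTensor A' B' →⋆ₐ[ℂ] SpatialTensor A B,
      ∀ a b, φψ (tmul a b) = tmul (φ a) (ψ b) := by
  -- Pulling back a pair of representations of the target gives one of the source, so its operators
  -- are already defined on the source tensor product.
  let T : SpatialTensor A' B' →⋆ₐ[ℂ] BoundedOperators A B :=
    lpHom fun p : RepPair A B => spatialEval (p.comp φ ψ)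
  let J : SpatialTensor A B →⋆ₐ[ℂ] BoundedOperators A B := (spatialSubalgebra A B).subtype
  have hJ : Function.Injective J := Subtype.val_injective
  have hT : ∀ a b, T (tmul a b) = J (tmul (φ a) (ψ b)) := fun a b => rfl
  have hS := spatial_eq_top (J.range.comap T)
    ((isClosed_range_of_injective J hJ).preimage (continuous_starAlgHom T))
    fun a b => ⟨tmul (φ a) (ψ b), (hT a b).symm⟩
  obtain ⟨θ, hθ⟩ := exists_factor T J hJ fun x => by
    have : x ∈ J.range.comap T := hS ▸ StarSubalgebra.mem_top
    exact this
  exact ⟨θ, fun a b => hJ ((hθ _).trans (hT a b))⟩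

end Spatial

/-! ### The Hopf algebra maps -/

/-- The matrix of the comultiplication is the product of the two commuting copies u ⊗ 1 and 1 ⊗ u of
the coordinate matrix. -/
theorem exists_comul (X : Label) (N : ℕ) :
    ∃ Δ : Fun X N →⋆ₐ[ℂ] SpatialTensor (Fun X N) (Fun X N),
      ∀ i j, Δ (coord X N i j) = ∑ k, tmul (coord X N i k) (coord X N k j) := by
  let v : Matrix (Fin N) (Fin N) (SpatialTensor (Fun X N) (Fun X N)) := (coord X N).map inclLeft
  let w : Matrix (Fin N) (Fin N) (SpatialTensor (Fun X N) (Fun X N)) := (coord X N).map inclRight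
  have h : Relations X (v * w) :=
    Relations.mul (fun i j k l => commute_inclLeft_inclRight _ _)
      (fun i j k l => by
        change Commute (inclLeft _) (star (inclRight (coord X N k l)))
        rw [← map_star]
        exact commute_inclLeft_inclRight _ _)
      ((relations_coord X N).map _) ((relations_coord X N).map _)
  obtain ⟨Δ, hΔ⟩ := exists_lift
    (fun p : RepPair (Fun X N) (Fun X N) => p.HK →L[ℂ] p.HK) spatialEval
    (fun _ _ h => spatial_ext h) (v * w) h
  refine ⟨Δ, fun i j => (hΔ i j).trans ?_⟩
  rw [Matrix.mul_apply]
  exact Finset.sum_congr rfl fun k _ => inclLeft_mul_inclRight _ _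


/-! ### Morphisms of C⋆-algebras have closed range -/

section ClosedRange

variable {C D : Type*} [CStarAlgebra C] [CStarAlgebra D]

/-- Truncate `a` at ±‖φ a‖ by functional calculus. The truncation is the identity on the spectrum of
`φ a`, so the image does not change. -/
theorem exists_lift_norm_le_of_isSelfAdjoint (φ : C →⋆ₐ[ℂ] D) {a : C} (ha : IsSelfAdjoint a) :
    ∃ a' : C, φ a' = φ a ∧ ‖a'‖ ≤ ‖φ a‖ := by
  have hφ := continuous_starAlgHom φ
  have hφa : IsSelfAdjoint (φ a) := ha.map φ
  set r := ‖φ a‖ with hr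
  have hr0 : 0 ≤ r := norm_nonneg _
  let f : ℝ → ℝ := fun t => max (-r) (min r t)
  have hf : Continuous f := by fun_prop
  refine ⟨cfc f a, ?_, norm_cfc_le hr0 fun x _ => ?_⟩
  · rw [φ.map_cfc f a hf.continuousOn hφ ha hφa]
    conv_rhs => rw [← cfc_id' ℝ (φ a) hφa]
    refine cfc_congr fun x hx => ?_
    have h1 := norm_apply_le_norm_cfc (fun x : ℝ => x) (φ a) hx
    rw [cfc_id' ℝ (φ a) hφa, Real.norm_eq_abs, abs_le] at h1
    change max (-r) (min r x) = x
    rw [min_eq_right h1.2, max_eq_right h1.1]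
  · rw [Real.norm_eq_abs, abs_le]
    exact ⟨le_max_left _ _, max_le (by linarith) (min_le_left _ _)⟩

-- The factor 2 comes from lifting the real and imaginary parts separately.
open ComplexStarModule in
theorem exists_lift_norm_le (φ : C →⋆ₐ[ℂ] D) (a : C) :
    ∃ a' : C, φ a' = φ a ∧ ‖a'‖ ≤ 2 * ‖φ a‖ := by
  have h1 : φ (ℜ a : C) = (ℜ (φ a) : D) := by
    simp [realPart_apply_coe, map_real_smul φ (continuous_starAlgHom φ), map_star]
  have h2 : φ (ℑ a : C) = (ℑ (φ a) : D) := by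
    simp [imaginaryPart_apply_coe, map_real_smul φ (continuous_starAlgHom φ), map_star]
  obtain ⟨x, hx, hx'⟩ := exists_lift_norm_le_of_isSelfAdjoint φ (ℜ a).2
  obtain ⟨y, hy, hy'⟩ := exists_lift_norm_le_of_isSelfAdjoint φ (ℑ a).2
  refine ⟨x + Complex.I • y, ?_, ?_⟩
  · rw [map_add, map_smul, hx, hy, ← map_smul, ← map_add, realPart_add_I_smul_imaginaryPart]
  · refine (norm_add_le _ _).trans ?_
    rw [norm_smul, Complex.norm_I, one_mul, two_mul]
    refine add_le_add (hx'.trans ?_) (hy'.trans ?_)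
    · rw [h1]
      exact realPart.norm_le (φ a)
    · rw [h2]
      exact imaginaryPart.norm_le (φ a)

/-- Lifts of controlled norm allow a limit of the range to be lifted as a convergent series in the
complete source. -/
theorem isClosed_range_starAlgHom (φ : C →⋆ₐ[ℂ] D) : IsClosed (φ.range : Set D) := by
  let f : NormedAddGroupHom C D := ⟨φ, map_add φ, 1, fun x => by
    simpa only [one_mul] using NonUnitalStarAlgHom.norm_apply_le φ x⟩
  let K : AddSubgroup D := (φ : C →+ D).range
  have hK : f.SurjectiveOnWith K 2 := by
    rintro _ ⟨a, rfl⟩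
    exact exists_lift_norm_le φ a
  have h := controlled_closure_of_complete two_pos one_pos hK
  have hKr : (K : Set D) = φ.range := rfl
  refine isClosed_of_closure_subset fun x hx => ?_
  obtain ⟨g, hg, -⟩ := h x (by rwa [← SetLike.mem_coe, AddSubgroup.topologicalClosure_coe, hKr])
  exact ⟨g, hg⟩

theorem surjective_of_coord_mem {X : Label} {N : ℕ} (φ : C →⋆ₐ[ℂ] Fun X N)
    (h : ∀ i j, coord X N i j ∈ φ.range) : Function.Surjective φ := fun x => by
  have : x ∈ φ.range := fun_eq_top φ.range (isClosed_range_starAlgHom φ) h ▸ StarSubalgebra.mem_top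
  exact this

end ClosedRange

/-! ### Diagonal matrices satisfying the relations -/

section Diagonal

variable {B : Type*} [Ring B] [StarRing B] {N : ℕ}

theorem letter_diagonal_of_ne (d : Fin N → B) (e : Bool) {a : Fin N × Fin N} (h : a.1 ≠ a.2) :
    letter (Matrix.diagonal d) e a = 0 := by
  cases e <;> simp [letter, h]

/-- Off the diagonal both sides vanish; on it the row and column signs coincide, so their product is
1 and the twist is invisible. -/
theorem signedPair_diagonal {s : Fin N → Fin N → ℤ} (hs : ∀ i j, s i j * s i j = 1)
    {d : Fin N → B} (hd : SignedPair (fun _ _ => 1) (Matrix.diagonal d)) :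
    SignedPair s (Matrix.diagonal d) := by
  rintro e f ⟨i, i'⟩ ⟨j, j'⟩
  by_cases hi : i = i'
  · by_cases hj : j = j'
    · subst hi hj
      simpa [hs] using hd e f (i, i) (j, j)
    · simp [letter_diagonal_of_ne d _ (a := (j, j')) hj]
  · simp [letter_diagonal_of_ne d _ (a := (i, i')) hi]

theorem signedTriple_diagonal {s : Fin N → Fin N → Fin N → ℤ}
    (hs : ∀ i j k, s i j k * s i j k = 1) {d : Fin N → B}
    (hd : SignedTriple (fun _ _ _ => 1) (Matrix.diagonal d)) :
    SignedTriple s (Matrix.diagonal d) := by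
  rintro e f g ⟨i, i'⟩ ⟨j, j'⟩ ⟨k, k'⟩
  by_cases hi : i = i'
  · by_cases hj : j = j'
    · by_cases hk : k = k'
      · subst hi hj hk
        simpa [hs] using hd e f g (i, i) (j, j) (k, k)
      · simp [letter_diagonal_of_ne d _ (a := (k, k')) hk]
    · simp [letter_diagonal_of_ne d _ (a := (j, j')) hj]
  · simp [letter_diagonal_of_ne d _ (a := (i, i')) hi]

theorem freeRelations_real_diagonal {d : Fin N → B} (h1 : ∀ i, star (d i) = d i)
    (h2 : ∀ i, d i * d i = 1) : FreeRelations .real (Matrix.diagonal d) := by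
  refine ⟨?_, ?_, ?_⟩
  · rw [Matrix.diagonal_map (star_zero _)]
    exact congrArg _ (funext h1)
  · simp [h2]
  · simp [h2]

theorem freeRelations_complex_diagonal {d : Fin N → B} (h1 : ∀ i, star (d i) * d i = 1)
    (h2 : ∀ i, d i * star (d i) = 1) : FreeRelations .complex (Matrix.diagonal d) := by
  refine ⟨⟨?_, ?_⟩, ?_, ?_⟩ <;>
    simp [Matrix.diagonal_map, Matrix.diagonal_conjTranspose, h1, h2]

end Diagonal

/-- Diagonal matrices over a commutative algebra satisfy all the column relations. -/
theorem columnRelations_diagonal_of_comm {B : Type*} [CommRing B] [StarRing B] {N : ℕ}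
    (d : Fin N → B) (c : Column) : ColumnRelations (Matrix.diagonal d) c := by
  have h2 : SignedPair (fun _ _ => 1) (Matrix.diagonal d) := fun e f a b => by
    simp [mul_comm]
  have h3 : SignedTriple (fun _ _ _ => 1) (Matrix.diagonal d) := fun e f g a b c => by
    simp only [mul_one, one_smul]; ring
  cases c with
  | classical => exact (columnRelations_classical_iff _).2 h2
  | half => exact (columnRelations_half_iff _).2 h3
  | free => trivial
  | twistedHalf =>
    exact (columnRelations_twistedHalf_iff _).2 (signedTriple_diagonal tripleSign_mul_self h3)
  | twisted =>
    exact (columnRelations_twisted_iff _).2 (signedPair_diagonal pairSign_mul_self h2)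

theorem relations_one_complex (X : Label) (N : ℕ) :
    Relations X (1 : Matrix (Fin N) (Fin N) ℂ) := by
  rw [← Matrix.diagonal_one]
  refine ⟨?_, columnRelations_diagonal_of_comm _ _⟩
  cases X.row with
  | real => exact freeRelations_real_diagonal (by simp) (by simp)
  | complex => exact freeRelations_complex_diagonal (by simp) (by simp)

theorem exists_hopfMaps (X : Label) (N : ℕ) : Nonempty (HopfMaps X N) := by
  obtain ⟨Δ, hΔ⟩ := exists_comul X N
  obtain ⟨ε, hε⟩ := exists_lift_small (relations_one_complex X N)
  obtain ⟨S, hS⟩ := exists_antipode X N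
  exact ⟨⟨Δ, hΔ, ε, fun i j => (hε i j).trans Matrix.one_apply, S, hS⟩⟩

/-! ### The inclusions of quantum groups -/

section Inclusions

variable {B : Type*} [Ring B] [StarRing B] {N : ℕ}

/-- Reversing abc exchanges each of the pairs ab, ac, bc once. -/
theorem SignedPair.signedTriple {s : Fin N → Fin N → ℤ} {u : Matrix (Fin N) (Fin N) B}
    (h : SignedPair s u) : SignedTriple (fun i j k => s i j * s i k * s j k) u := by
  intro e f g a b c
  rw [h e f a b, smul_mul_assoc, mul_assoc, h e g a c, mul_smul_comm, ← mul_assoc,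
    h f g b c, smul_mul_assoc, smul_smul, smul_smul]
  congr 1
  ring

/-- Three distinct indices give three factors -1, exactly two equal ones give two such factors, and
three equal ones give none. -/
theorem tripleSign_eq (i j k : Fin N) :
    tripleSign i j k = pairSign i j * pairSign i k * pairSign j k := by
  unfold tripleSign pairSign
  by_cases h1 : i = j <;> by_cases h2 : i = k <;> by_cases h3 : j = k <;>
    simp_all [Finset.card_insert_of_notMem]

/-- The relations are preserved along the arrows of the diagram. -/
theorem Arrow.relations {X Y : Label} (h : Arrow X Y) {u : Matrix (Fin N) (Fin N) B}
    (hu : Relations X u) : Relations Y u := by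
  obtain ⟨h1, h2⟩ := hu
  cases h with
  | classical_half r =>
    refine ⟨h1, (columnRelations_half_iff u).2 ?_⟩
    simpa using ((columnRelations_classical_iff u).1 h2).signedTriple
  | half_free r => exact ⟨h1, trivial⟩
  | twistedHalf_free r => exact ⟨h1, trivial⟩
  | twisted_twistedHalf r =>
    refine ⟨h1, (columnRelations_twistedHalf_iff u).2 ?_⟩
    have h3 := ((columnRelations_twisted_iff u).1 h2).signedTriple
    simpa only [← tripleSign_eq] using h3
  | vertical c => exact ⟨h1.complex_of_real, h2⟩

end Inclusions

/-- Each compatibility equates two morphisms, which agree as soon as they agree on coordinates. -/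
theorem isInclusion_of_map_coord {X Y : Label} {N : ℕ} (h : HopfMaps X N) (g : HopfMaps Y N)
    (p : Fun Y N →⋆ₐ[ℂ] Fun X N) (hp : ∀ i j, p (coord Y N i j) = coord X N i j) :
    IsInclusion h g p where
  surjective := surjective_of_coord_mem p fun i j => ⟨_, hp i j⟩
  map_coord := hp
  map_comul := by
    obtain ⟨pp, hpp⟩ := exists_spatialMap p p
    refine ⟨pp, hpp, fun a => ?_⟩
    have key : h.comul.comp p = pp.comp g.comul := fun_hom_ext fun i j => by
      simp only [StarAlgHom.comp_apply, hp, h.comul_coord, g.comul_coord, map_sum, hpp]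
    exact DFunLike.congr_fun key a
  map_counit a := by
    have key : h.counit.comp p = g.counit := fun_hom_ext fun i j => by
      simp only [StarAlgHom.comp_apply, hp, h.counit_coord, g.counit_coord]
    exact DFunLike.congr_fun key a
  map_antipode a := by
    have key : h.antipode.comp p = (opHom p).comp g.antipode := fun_hom_ext fun i j => by
      simp only [StarAlgHom.comp_apply, hp, h.antipode_coord, g.antipode_coord]
      change _ = MulOpposite.op (p (star _))
      rw [map_star, hp]
    exact DFunLike.congr_fun key a

/-! ### Properness of the inclusions -/

/-- If the canonical morphism is injective, all the models of the larger quantum group are models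
of the smaller one. -/
theorem relations_of_injective {X Y : Label} {N : ℕ} {p : Fun Y N →⋆ₐ[ℂ] Fun X N}
    (hp : ∀ i j, p (coord Y N i j) = coord X N i j) (hinj : Function.Injective p)
    {B : Type} [CStarAlgebra B] [Nontrivial B] {v : Matrix (Fin N) (Fin N) B}
    (hv : Relations Y v) : Relations X v := by
  have h1 : (coord Y N).map p = coord X N := Matrix.ext hp
  have h2 : Relations X (coord Y N) := Relations.of_map hinj (h1 ▸ relations_coord X N)
  exact h2.map (Model.eval ⟨B, v, hv⟩)

/-- The algebra of `2 × 2` complex matrices, as a C⋆-algebra. -/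
def MatTwo : Type := Matrix (Fin 2) (Fin 2) ℂ

instance : CStarAlgebra MatTwo := Matrix.instCStarAlgebra (n := Fin 2)

instance : Nontrivial MatTwo := inferInstanceAs (Nontrivial (Matrix (Fin 2) (Fin 2) ℂ))

/-- A complex matrix as an element of the C⋆-algebra `MatTwo`. -/
def toMatTwo : Matrix (Fin 2) (Fin 2) ℂ ≃ MatTwo := Equiv.refl _

theorem toMatTwo_mul (a b : Matrix (Fin 2) (Fin 2) ℂ) :
    toMatTwo (a * b) = toMatTwo a * toMatTwo b := rfl

theorem toMatTwo_one : toMatTwo 1 = 1 := rfl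

theorem toMatTwo_star (a : Matrix (Fin 2) (Fin 2) ℂ) : toMatTwo (star a) = star (toMatTwo a) :=
  rfl

/-- The self-adjoint antidiagonal matrix with upper right entry `z`. -/
def antidiag (z : ℂ) : MatTwo := toMatTwo !![0, z; star z, 0]

theorem star_antidiag (z : ℂ) : star (antidiag z) = antidiag z := by
  rw [antidiag, ← toMatTwo_star]
  congr 1
  ext i j
  fin_cases i <;> fin_cases j <;> simp [Matrix.star_apply]

/-- The resulting scalar is symmetric in `z` and `t`, so these matrices half-commute. -/
theorem antidiag_mul_mul (z w t : ℂ) :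
    antidiag z * antidiag w * antidiag t = antidiag (z * star w * t) := by
  simp only [antidiag, ← toMatTwo_mul]
  congr 1
  ext i j
  fin_cases i <;> fin_cases j <;> simp

theorem antidiag_mul_self {z : ℂ} (hz : z * star z = 1) : antidiag z * antidiag z = 1 := by
  have hz' : star z * z = 1 := by rw [mul_comm, hz]
  simp only [antidiag, ← toMatTwo_mul, ← toMatTwo_one]
  congr 1
  ext i j
  fin_cases i <;> fin_cases j <;> simp_all

/-- The diagonal Pauli matrix. -/
def pauliZ : MatTwo := toMatTwo !![1, 0; 0, -1]

theorem star_pauliZ : star pauliZ = pauliZ := by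
  rw [pauliZ, ← toMatTwo_star]
  congr 1
  ext i j
  fin_cases i <;> fin_cases j <;> simp [Matrix.star_apply]

theorem pauliZ_mul_self : pauliZ * pauliZ = 1 := by
  simp only [pauliZ, ← toMatTwo_mul, ← toMatTwo_one]
  congr 1
  ext i j
  fin_cases i <;> fin_cases j <;> simp

theorem antidiag_mul_ne :
    antidiag 1 * antidiag Complex.I ≠ antidiag Complex.I * antidiag 1 := by
  simp only [antidiag, ← toMatTwo_mul]
  intro h
  have h1 := congrFun (congrFun (toMatTwo.injective h) 0) 0
  simp [Complex.ext_iff] at h1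
  norm_num at h1

/-- The two products are the scalars -i and i. -/
theorem pauli_mul_ne : antidiag 1 * antidiag Complex.I * pauliZ ≠
    pauliZ * antidiag Complex.I * antidiag 1 := by
  simp only [antidiag, pauliZ, ← toMatTwo_mul]
  intro h
  have h1 := congrFun (congrFun (toMatTwo.injective h) 0) 0
  simp [Complex.ext_iff] at h1
  norm_num at h1

/-- The diagonal of a half-commuting, noncommuting model. -/
def halfDiag (N : ℕ) (i : Fin N) : MatTwo := antidiag (if i.1 = 1 then Complex.I else 1)

/-- The diagonal of a model which is not half-commuting. -/
def pauliDiag (N : ℕ) (i : Fin N) : MatTwo :=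
  if i.1 = 0 then antidiag 1 else if i.1 = 1 then antidiag Complex.I else pauliZ

theorem freeRelations_halfDiag (N : ℕ) : FreeRelations .real (Matrix.diagonal (halfDiag N)) :=
  freeRelations_real_diagonal (fun i => star_antidiag _) fun i =>
    antidiag_mul_self (by split_ifs <;> simp)

theorem freeRelations_pauliDiag (N : ℕ) : FreeRelations .real (Matrix.diagonal (pauliDiag N)) :=
  freeRelations_real_diagonal
    (fun i => by unfold pauliDiag; split_ifs <;> simp only [star_antidiag, star_pauliZ])
    (fun i => by
      unfold pauliDiag
      split_ifs
      · exact antidiag_mul_self (by simp)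
      · exact antidiag_mul_self (by simp)
      · exact pauliZ_mul_self)

theorem signedTriple_halfDiag (N : ℕ) :
    SignedTriple (fun _ _ _ => 1) (Matrix.diagonal (halfDiag N)) := by
  rintro e f g ⟨i, i'⟩ ⟨j, j'⟩ ⟨k, k'⟩
  simp only [letter_of_map_star (freeRelations_halfDiag N).1, mul_one, one_smul]
  by_cases hi : i = i'
  · by_cases hj : j = j'
    · by_cases hk : k = k'
      · subst hi hj hk
        simp only [Matrix.diagonal_apply_eq, halfDiag, antidiag_mul_mul]
        congr 1
        ring
      · simp [hk]
    · simp [hj]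
  · simp [hi]

theorem FreeRelations.of_real {B : Type*} [Ring B] [StarRing B] {N : ℕ}
    {u : Matrix (Fin N) (Fin N) B} (h : FreeRelations .real u) (r : Row) : FreeRelations r u := by
  cases r
  · exact h
  · exact h.complex_of_real

theorem not_aligned_diagonal {N : ℕ} (i j : Fin N) : ¬ Aligned (i, i) (j, j) := by
  rintro ⟨h1, h2⟩
  simp_all

theorem not_oddSpan_diagonal {N : ℕ} (i j k : Fin N) : ¬ OddSpan (i, i) (j, j) (k, k) := by
  unfold OddSpan rowSpan colSpan
  simp only
  omega

/-- None of the arrows of the diagram is an isomorphism. -/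
theorem Arrow.not_injective {X Y : Label} (h : Arrow X Y) {N : ℕ} (hN : 3 ≤ N)
    {p : Fun Y N →⋆ₐ[ℂ] Fun X N} (hp : ∀ i j, p (coord Y N i j) = coord X N i j) :
    ¬ Function.Injective p := by
  intro hinj
  let i₀ : Fin N := ⟨0, by omega⟩
  let i₁ : Fin N := ⟨1, by omega⟩
  let i₂ : Fin N := ⟨2, by omega⟩
  cases h with
  | classical_half r =>
    have h1 := (relations_of_injective hp hinj (v := Matrix.diagonal (halfDiag N))
      ⟨(freeRelations_halfDiag N).of_real r,
        (columnRelations_half_iff _).2 (signedTriple_halfDiag N)⟩).2 false false (i₀, i₀) (i₁, i₁)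
    exact antidiag_mul_ne (by simpa [letter, halfDiag, i₀, i₁] using h1)
  | half_free r =>
    have h1 := (relations_of_injective hp hinj (v := Matrix.diagonal (pauliDiag N))
      ⟨(freeRelations_pauliDiag N).of_real r, trivial⟩).2 false false false
        (i₀, i₀) (i₁, i₁) (i₂, i₂)
    exact pauli_mul_ne (by simpa [letter, pauliDiag, i₀, i₁, i₂] using h1)
  | twistedHalf_free r =>
    have h1 := (relations_of_injective hp hinj (v := Matrix.diagonal (pauliDiag N))
      ⟨(freeRelations_pauliDiag N).of_real r, trivial⟩).2 false false false
        (i₀, i₀) (i₁, i₁) (i₂, i₂)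
    rw [if_neg (not_oddSpan_diagonal _ _ _)] at h1
    exact pauli_mul_ne (by simpa [letter, pauliDiag, i₀, i₁, i₂] using h1)
  | twisted_twistedHalf r =>
    -- The untwisted half-commuting example remains valid, being diagonal, and its diagonal
    -- positions are never aligned, so the twisted relations would force it to commute.
    have h1 := (relations_of_injective hp hinj (v := Matrix.diagonal (halfDiag N))
      ⟨(freeRelations_halfDiag N).of_real r, (columnRelations_twistedHalf_iff _).2
        (signedTriple_diagonal tripleSign_mul_self (signedTriple_halfDiag N))⟩).2
          false false (i₀, i₀) (i₁, i₁)
    rw [if_neg (not_aligned_diagonal _ _)] at h1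
    exact antidiag_mul_ne (by simpa [letter, halfDiag, i₀, i₁] using h1)
  | vertical c =>
    -- The scalar matrix i is unitary but not self-adjoint, and being diagonal over ℂ it satisfies
    -- the relations of every column.
    have h1 := (relations_of_injective hp hinj
      (v := Matrix.diagonal fun _ : Fin N => Complex.I)
      ⟨freeRelations_complex_diagonal (by simp) (by simp),
        columnRelations_diagonal_of_comm _ c⟩).1.1
    have h2 := congrFun (congrFun h1 i₀) i₀
    simp [Complex.ext_iff] at h2
    norm_num at h2


/-! ### Classical versions -/

section Classical

variable {N : ℕ}

theorem classicalVersion_eq (X : Label) (N : ℕ) :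
    classicalVersion X N = {M | Relations X M} := by
  ext M
  constructor
  · rintro ⟨χ, hχ⟩
    have h1 : (coord X N).map χ = M := Matrix.ext hχ
    exact h1 ▸ (relations_coord X N).map χ
  · exact fun h => exists_lift_small h

theorem freeRelations_complex_iff_mem_unitaryGroup (M : Matrix (Fin N) (Fin N) ℂ) :
    FreeRelations .complex M ↔ M ∈ Matrix.unitaryGroup (Fin N) ℂ := by
  constructor
  · exact fun h => Matrix.mem_unitaryGroup_iff.2 h.1.2
  · intro h
    have h1 : M * Mᴴ = 1 := Matrix.mem_unitaryGroup_iff.1 h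
    have h2 : Mᴴ * M = 1 := Matrix.mem_unitaryGroup_iff'.1 h
    have h3 : M.map star = Mᴴᵀ := rfl
    refine ⟨⟨h2, h1⟩, ?_, ?_⟩
    · rw [h3, ← Matrix.transpose_mul, h2, Matrix.transpose_one]
    · rw [h3, ← Matrix.transpose_mul, h1, Matrix.transpose_one]

theorem freeRelations_real_iff (M : Matrix (Fin N) (Fin N) ℂ) :
    FreeRelations .real M ↔ M.map star = M ∧ FreeRelations .complex M := by
  refine ⟨fun h => ⟨h.1, h.complex_of_real⟩, fun ⟨h1, _, h2, h3⟩ => ⟨h1, ?_, ?_⟩⟩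
  · rwa [h1] at h2
  · rwa [h1] at h3

theorem freeRelations_iff_mem_classicalGroup (r : Row) (M : Matrix (Fin N) (Fin N) ℂ) :
    FreeRelations r M ↔ M ∈ classicalGroup N r := by
  cases r with
  | complex => exact freeRelations_complex_iff_mem_unitaryGroup M
  | real =>
    constructor
    · rintro ⟨h1, h2, h3⟩
      have hR : (M.map Complex.re).map Complex.ofReal = M := Matrix.ext fun i j =>
        Complex.conj_eq_iff_re.1 (congrFun (congrFun h1 i) j)
      refine ⟨M.map Complex.re, ?_, hR⟩
      rw [SetLike.mem_coe, Matrix.mem_orthogonalGroup_iff]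
      apply Matrix.map_injective Complex.ofReal_injective
      change (M.map Complex.re * (M.map Complex.re)ᵀ).map Complex.ofRealHom =
        (1 : Matrix (Fin N) (Fin N) ℝ).map Complex.ofRealHom
      rw [Matrix.map_mul, Matrix.map_one _ (map_zero _) (map_one _), ← Matrix.transpose_map]
      change (M.map Complex.re).map Complex.ofReal * ((M.map Complex.re).map Complex.ofReal)ᵀ = 1
      rw [hR, h3]
    · rintro ⟨R, hR, rfl⟩
      have h1 : R * Rᵀ = 1 := (Matrix.mem_orthogonalGroup_iff (Fin N) ℝ).1 hR
      have h2 : Rᵀ * R = 1 := (Matrix.mem_orthogonalGroup_iff' (Fin N) ℝ).1 hR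
      refine ⟨Matrix.ext fun i j => Complex.conj_ofReal _, ?_, ?_⟩
      · change (Rᵀ.map Complex.ofRealHom) * R.map Complex.ofRealHom = 1
        rw [← Matrix.map_mul, h2, Matrix.map_one _ (map_zero _) (map_one _)]
      · change R.map Complex.ofRealHom * (Rᵀ.map Complex.ofRealHom) = 1
        rw [← Matrix.map_mul, h1, Matrix.map_one _ (map_zero _) (map_one _)]

theorem letter_eq_zero_iff (M : Matrix (Fin N) (Fin N) ℂ) (e : Bool) (a : Fin N × Fin N) :
    letter M e a = 0 ↔ M a.1 a.2 = 0 := by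
  cases e <;> simp [letter]

/-- In ℂ the odd-span relation equates a product with its own negative. Conversely, stars do not
affect which products of entries vanish. -/
theorem columnRelations_twistedHalf_iff_mul_eq_zero (M : Matrix (Fin N) (Fin N) ℂ) :
    ColumnRelations M .twistedHalf ↔ ∀ a b c : Fin N × Fin N, OddSpan a b c →
      M a.1 a.2 * M b.1 b.2 * M c.1 c.2 = 0 := by
  constructor
  · intro h a b c ho
    have h1 := h false false false a b c
    have h2 : letter M false c * letter M false b * letter M false a =
        letter M false a * letter M false b * letter M false c := by ring
    rw [if_pos ho, h2, self_eq_neg] at h1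
    exact h1
  · intro h e f g a b c
    split_ifs with ho
    · have h1 : letter M e a * letter M f b * letter M g c = 0 := by
        simpa only [mul_eq_zero, letter_eq_zero_iff] using h a b c ho
      rw [h1, mul_comm (letter M g c), mul_assoc, mul_comm (letter M g c), ← mul_assoc,
        mul_comm (letter M f b), h1, neg_zero]
    · ring

theorem columnRelations_twisted_iff_mul_eq_zero (M : Matrix (Fin N) (Fin N) ℂ) :
    ColumnRelations M .twisted ↔ ∀ a b : Fin N × Fin N, Aligned a b →
      M a.1 a.2 * M b.1 b.2 = 0 := by
  constructor
  · intro h a b ho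
    have h1 := h false false a b
    rw [if_pos ho, mul_comm (letter M false b), self_eq_neg] at h1
    exact h1
  · intro h e f a b
    split_ifs with ho
    · have h1 : letter M e a * letter M f b = 0 := by
        simpa only [mul_eq_zero, letter_eq_zero_iff] using h a b ho
      rw [mul_comm (letter M f b), h1, neg_zero]
    · ring

/-- The unitary matrices in which any two aligned entries have product zero are the monomial
matrices. -/
theorem unitary_twisted_iff (M : Matrix (Fin N) (Fin N) ℂ) :
    Relations ⟨.complex, .twisted⟩ M ↔ ∃ (σ : Equiv.Perm (Fin N)) (z : Fin N → ℂ),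
      (∀ i, star (z i) * z i = 1) ∧ M = Matrix.of fun i j => if i = σ j then z i else 0 := by
  unfold Relations
  rw [columnRelations_twisted_iff_mul_eq_zero]
  constructor
  · rintro ⟨⟨⟨h1, -⟩, -⟩, h2⟩
    have hcol : ∀ j, ∑ i, star (M i j) * M i j = 1 := fun j => by
      simpa [Matrix.mul_apply] using congrFun (congrFun h1 j) j
    -- Columns of norm one supply a nonzero entry; alignment then makes it the only one in its row
    -- and column.
    have hex : ∀ j, ∃ i, M i j ≠ 0 := fun j => by
      by_contra! h
      simpa [h] using hcol j
    choose σ hσ using hex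
    have hinj : Function.Injective σ := fun j j' hj => by
      by_contra hne
      refine mul_ne_zero (hσ j) (hσ j') (h2 (σ j, j) (σ j', j') ⟨?_, Or.inl hj⟩)
      simp [hne]
    let τ : Equiv.Perm (Fin N) := Equiv.ofBijective σ (Finite.injective_iff_bijective.1 hinj)
    have hzero : ∀ i j, i ≠ σ j → M i j = 0 := fun i j hij => by
      have h3 := h2 (i, j) (σ j, j) ⟨by simp [hij], Or.inr rfl⟩
      exact (mul_eq_zero.1 h3).resolve_right (hσ j)
    have hτ : ∀ j, τ j = σ j := fun j => rfl
    -- The scalars are indexed by rows, hence the inverse permutation.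
    refine ⟨τ, fun i => M i (τ.symm i), fun i => ?_, ?_⟩
    · rw [← hcol (τ.symm i), Finset.sum_eq_single i]
      · intro k _ hk
        rw [hzero k _ (by rw [← hτ, τ.apply_symm_apply]; exact hk), mul_zero]
      · simp
    · ext i j
      rw [Matrix.of_apply]
      split_ifs with h
      · have h3 : τ.symm i = j := by rw [h, τ.symm_apply_apply]
        simp only [h3]
      · exact hzero i j h
  · rintro ⟨σ, z, hz, rfl⟩
    refine ⟨?_, ?_⟩
    · rw [freeRelations_complex_iff_mem_unitaryGroup, Matrix.mem_unitaryGroup_iff']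
      ext j k
      rw [Matrix.mul_apply, Finset.sum_eq_single (σ j)]
      · by_cases h : j = k
        · subst h; simpa [Matrix.star_apply] using hz (σ j)
        · simp [Matrix.star_apply, h]
      · intro i _ hi
        simp [Matrix.star_apply, hi]
      · simp
    · rintro ⟨i, j⟩ ⟨k, l⟩ ⟨hne, h⟩
      by_contra h0
      have h1 : i = σ j := by by_contra h1; simp [h1] at h0
      have h2 : k = σ l := by by_contra h2; simp [h2] at h0
      subst h1 h2
      rcases h with h | h
      · exact hne (by rw [σ.injective h])
      · exact hne (by simp only at h; rw [h])

theorem star_mul_self_eq_one_iff_exists_circle (z : ℂ) :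
    star z * z = 1 ↔ ∃ w : Circle, (w : ℂ) = z := by
  constructor
  · intro h
    refine ⟨⟨z, mem_sphere_zero_iff_norm.2 ?_⟩, rfl⟩
    have h1 := congrArg norm h
    rw [norm_mul, norm_star, norm_one] at h1
    nlinarith [norm_nonneg z]
  · rintro ⟨w, rfl⟩
    rw [mul_comm]
    change (w : ℂ) * (starRingEnd ℂ) w = 1
    rw [Complex.mul_conj, Circle.normSq_coe, Complex.ofReal_one]

theorem self_adjoint_unit_iff_exists_sign (z : ℂ) :
    (star z = z ∧ star z * z = 1) ↔ ∃ ε : ℤˣ, ((ε : ℤ) : ℂ) = z := by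
  constructor
  · rintro ⟨h1, h2⟩
    rw [h1] at h2
    rcases mul_self_eq_one_iff.1 h2 with rfl | rfl
    · exact ⟨1, by simp⟩
    · exact ⟨-1, by simp⟩
  · rintro ⟨ε, rfl⟩
    rcases Int.units_eq_one_or ε with rfl | rfl <;> simp

theorem relations_twisted_iff_mem_monomialGroup (r : Row) (M : Matrix (Fin N) (Fin N) ℂ) :
    Relations ⟨r, .twisted⟩ M ↔ M ∈ monomialGroup N r := by
  cases r with
  | complex =>
    rw [unitary_twisted_iff]
    constructor
    · rintro ⟨σ, z, hz, rfl⟩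
      choose w hw using fun i => (star_mul_self_eq_one_iff_exists_circle (z i)).1 (hz i)
      exact ⟨σ, w, by simp only [hw]⟩
    · rintro ⟨σ, w, rfl⟩
      exact ⟨σ, fun i => w i, fun i => (star_mul_self_eq_one_iff_exists_circle _).2 ⟨w i, rfl⟩, rfl⟩
  | real =>
    have h : Relations ⟨.real, .twisted⟩ M ↔ M.map star = M ∧ Relations ⟨.complex, .twisted⟩ M := by
      unfold Relations
      rw [freeRelations_real_iff, and_assoc]
    rw [h, unitary_twisted_iff]
    constructor
    · rintro ⟨hs, σ, z, hz, rfl⟩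
      have hs' : ∀ i, star (z i) = z i := fun i => by
        simpa using congrFun (congrFun hs i) (σ.symm i)
      choose w hw using fun i => (self_adjoint_unit_iff_exists_sign (z i)).1 ⟨hs' i, hz i⟩
      exact ⟨σ, w, by simp only [hw]⟩
    · rintro ⟨σ, w, rfl⟩
      have hw := fun i => (self_adjoint_unit_iff_exists_sign _).2 ⟨w i, rfl⟩
      refine ⟨?_, σ, fun i => ((w i : ℤ) : ℂ), fun i => (hw i).2, rfl⟩
      ext i j
      simp only [Matrix.map_apply, Matrix.of_apply]
      split_ifs
      · exact (hw i).1
      · exact star_zero _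

theorem classicalVersion_eq_classicalTable (X : Label) (N : ℕ) :
    classicalVersion X N = classicalTable N X := by
  rw [classicalVersion_eq]
  ext M
  rcases X with ⟨r, c⟩
  cases c with
  | classical =>
    exact (and_iff_left fun e f a b => mul_comm _ _).trans (freeRelations_iff_mem_classicalGroup r M)
  | half =>
    exact (and_iff_left fun e f g a b c => by ring).trans (freeRelations_iff_mem_classicalGroup r M)
  | free => exact (and_iff_left trivial).trans (freeRelations_iff_mem_classicalGroup r M)
  | twistedHalf =>
    exact and_congr (freeRelations_iff_mem_classicalGroup r M)
      (columnRelations_twistedHalf_iff_mul_eq_zero M)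
  | twisted => exact relations_twisted_iff_mem_monomialGroup r M

end Classical

/-! ### Gelfand duality for the classical quantum groups -/

section Gelfand

/-- The characters of a commutative C⋆-algebra separate its points. -/
theorem eq_of_forall_character {R : Type*} [CStarAlgebra R] (hc : ∀ x y : R, x * y = y * x)
    {x y : R} (h : ∀ χ : R →⋆ₐ[ℂ] ℂ, χ x = χ y) : x = y := by
  let _ : CommCStarAlgebra R := { (inferInstance : CStarAlgebra R) with mul_comm := hc }
  refine (gelfandTransform_isometry R).injective (ContinuousMap.ext fun χ => ?_)
  exact h ⟨WeakDual.CharacterSpace.toAlgHom χ, map_star χ⟩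

/-- Density is used twice: first every element commutes with each coordinate, then the coordinates
lie in the centre, which is therefore everything. -/
theorem fun_classical_mul_comm {r : Row} {N : ℕ} (x y : Fun ⟨r, .classical⟩ N) :
    x * y = y * x := by
  have hcl : ∀ s : Set (Fun ⟨r, .classical⟩ N),
      IsClosed (StarSubalgebra.centralizer ℂ s : Set (Fun ⟨r, .classical⟩ N)) := fun s => by
    rw [StarSubalgebra.coe_centralizer]
    exact Set.isClosed_centralizer _
  have hcomm := (relations_coord ⟨r, .classical⟩ N).2
  have h1 : ∀ i j, StarSubalgebra.centralizer ℂ {coord ⟨r, .classical⟩ N i j} = ⊤ := fun i j => by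
    refine fun_eq_top _ (hcl _) fun k l => ?_
    rw [StarSubalgebra.mem_centralizer_iff]
    rintro _ rfl
    exact ⟨hcomm false false (i, j) (k, l), hcomm true false (i, j) (k, l)⟩
  have h2 : StarSubalgebra.centralizer ℂ (Set.univ : Set (Fun ⟨r, .classical⟩ N)) = ⊤ := by
    refine fun_eq_top _ (hcl _) fun i j => ?_
    have h3 : ∀ z, z * coord ⟨r, .classical⟩ N i j = coord ⟨r, .classical⟩ N i j * z := fun z => by
      have h4 : z ∈ StarSubalgebra.centralizer ℂ {coord ⟨r, .classical⟩ N i j} :=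
        h1 i j ▸ StarSubalgebra.mem_top
      exact ((StarSubalgebra.mem_centralizer_iff ℂ).1 h4 _ rfl).1.symm
    exact (StarSubalgebra.mem_centralizer_iff ℂ).2 fun z _ => ⟨h3 z, h3 (star z)⟩
  have h5 : y ∈ StarSubalgebra.centralizer ℂ (Set.univ : Set (Fun ⟨r, .classical⟩ N)) :=
    h2 ▸ StarSubalgebra.mem_top
  exact ((StarSubalgebra.mem_centralizer_iff ℂ).1 h5 x trivial).1

/-- A compact space of matrices, which is in bijection with the classical group, has `C(G)` as
algebra of continuous functions. -/
theorem exists_starAlgEquiv_continuousMap {r : Row} {N : ℕ} {K : Type} [TopologicalSpace K]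
    [CompactSpace K] [Nonempty K] (c : Matrix (Fin N) (Fin N) C(K, ℂ))
    (hmem : ∀ g, (Matrix.of fun i j => c i j g) ∈ classicalGroup N r)
    (hinj : ∀ g g', (∀ i j, c i j g = c i j g') → g = g')
    (hsurj : ∀ M ∈ classicalGroup N r, ∃ g, ∀ i j, c i j g = M i j) :
    ∃ e : Fun ⟨r, .classical⟩ N ≃⋆ₐ[ℂ] C(K, ℂ),
      ∀ i j, e (coord ⟨r, .classical⟩ N i j) = c i j := by
  let ev : K → C(K, ℂ) →⋆ₐ[ℂ] ℂ := fun g => ContinuousMap.evalStarAlgHom ℂ ℂ g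
  have hrel : Relations ⟨r, .classical⟩ c := by
    refine ⟨FreeRelations.of_map (f := ev) (fun x y h => ContinuousMap.ext h) fun g => ?_,
      fun e f a b => mul_comm _ _⟩
    exact (freeRelations_iff_mem_classicalGroup r _).2 (hmem g)
  obtain ⟨T, hT⟩ := exists_lift_small hrel
  -- Every character is evaluation at a point of `K` composed with `T`, and characters separate
  -- points.
  have hTinj : Function.Injective T := fun x y hxy => by
    refine eq_of_forall_character fun_classical_mul_comm fun χ => ?_
    have hχ : (Matrix.of fun i j => χ (coord ⟨r, .classical⟩ N i j)) ∈ classicalGroup N r :=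
      (freeRelations_iff_mem_classicalGroup r _).1
        ((relations_coord ⟨r, .classical⟩ N).map χ).1
    obtain ⟨g, hg⟩ := hsurj _ hχ
    have key : χ = (ev g).comp T := fun_hom_ext fun i j => by
      rw [StarAlgHom.comp_apply, hT]
      exact (hg i j).symm
    rw [key, StarAlgHom.comp_apply, StarAlgHom.comp_apply, hxy]
  -- The range is dense by Stone–Weierstrass, and closed.
  have hTsurj : Function.Surjective T := by
    have h1 : T.range.SeparatesPoints := by
      intro g g' hne
      by_contra! h
      refine hne (hinj g g' fun i j => ?_)
      exact h (c i j) ⟨c i j, ⟨_, hT i j⟩, rfl⟩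
    have h2 := ContinuousMap.starSubalgebra_topologicalClosure_eq_top_of_separatesPoints T.range h1
    intro f
    have h3 : f ∈ (T.range.topologicalClosure : Set C(K, ℂ)) := by
      rw [h2]; trivial
    rw [StarSubalgebra.topologicalClosure_coe, (isClosed_range_starAlgHom T).closure_eq] at h3
    exact h3
  exact ⟨StarAlgEquiv.ofBijective T ⟨hTinj, hTsurj⟩, hT⟩

/-- A closed subset of a product of closed unit balls; the case of real scalars covers the
orthogonal group. -/
instance compactSpace_unitaryGroup (N : ℕ) (𝕜 : Type*) [RCLike 𝕜] :
    CompactSpace (Matrix.unitaryGroup (Fin N) 𝕜) := by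
  suffices h : IsCompact (Matrix.unitaryGroup (Fin N) 𝕜 : Set (Matrix (Fin N) (Fin N) 𝕜)) from
    isCompact_iff_compactSpace.1 h
  have h1 : IsCompact (Set.univ.pi fun _ : Fin N => Set.univ.pi fun _ : Fin N =>
      Metric.closedBall (0 : 𝕜) 1) :=
    isCompact_univ_pi fun _ => isCompact_univ_pi fun _ => isCompact_closedBall _ _
  refine h1.of_isClosed_subset ?_ ?_
  · have h2 : (Matrix.unitaryGroup (Fin N) 𝕜 : Set (Matrix (Fin N) (Fin N) 𝕜)) =
        {M | M * star M = 1} := Set.ext fun M => Matrix.mem_unitaryGroup_iff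
    rw [h2]
    exact isClosed_eq (continuous_id.matrix_mul continuous_id.matrix_conjTranspose)
      continuous_const
  · intro M hM i _ j _
    rw [mem_closedBall_zero_iff]
    exact entry_norm_bound_of_unitary hM i j

/-- The standard coordinates on the orthogonal group. -/
def orthogonalCoord (N : ℕ) : Matrix (Fin N) (Fin N) C(Matrix.orthogonalGroup (Fin N) ℝ, ℂ) :=
  fun i j => ⟨fun g => ((g : Matrix (Fin N) (Fin N) ℝ) i j : ℂ),
    Complex.continuous_ofReal.comp (continuous_subtype_val.matrix_elem i j)⟩

/-- The standard coordinates on the unitary group. -/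
def unitaryCoord (N : ℕ) : Matrix (Fin N) (Fin N) C(Matrix.unitaryGroup (Fin N) ℂ, ℂ) :=
  fun i j => ⟨fun g => (g : Matrix (Fin N) (Fin N) ℂ) i j,
    continuous_subtype_val.matrix_elem i j⟩

theorem exists_starAlgEquiv_orthogonalGroup (N : ℕ) :
    ∃ e : Fun ⟨.real, .classical⟩ N ≃⋆ₐ[ℂ] C(Matrix.orthogonalGroup (Fin N) ℝ, ℂ),
      ∀ i j g, e (coord ⟨.real, .classical⟩ N i j) g = ((g : Matrix _ _ ℝ) i j : ℂ) := by
  have hmem : ∀ g, (Matrix.of fun i j => orthogonalCoord N i j g) ∈ classicalGroup N .real :=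
    fun g => ⟨g.1, g.2, rfl⟩
  have hinj : ∀ g g', (∀ i j, orthogonalCoord N i j g = orthogonalCoord N i j g') → g = g' :=
    fun g g' h => Subtype.ext (Matrix.ext fun i j => Complex.ofReal_injective (h i j))
  have hsurj : ∀ M ∈ classicalGroup N .real, ∃ g, ∀ i j, orthogonalCoord N i j g = M i j := by
    rintro _ ⟨R, hR, rfl⟩
    exact ⟨⟨R, hR⟩, fun i j => rfl⟩
  obtain ⟨e, he⟩ := exists_starAlgEquiv_continuousMap (orthogonalCoord N) hmem hinj hsurj
  refine ⟨e, fun i j g => ?_⟩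
  rw [he]
  rfl

theorem exists_starAlgEquiv_unitaryGroup (N : ℕ) :
    ∃ e : Fun ⟨.complex, .classical⟩ N ≃⋆ₐ[ℂ] C(Matrix.unitaryGroup (Fin N) ℂ, ℂ),
      ∀ i j g, e (coord ⟨.complex, .classical⟩ N i j) g = (g : Matrix _ _ ℂ) i j := by
  have hmem : ∀ g, (Matrix.of fun i j => unitaryCoord N i j g) ∈ classicalGroup N .complex :=
    fun g => g.2
  have hinj : ∀ g g', (∀ i j, unitaryCoord N i j g = unitaryCoord N i j g') → g = g' :=
    fun g g' h => Subtype.ext (Matrix.ext fun i j => h i j)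
  have hsurj : ∀ M ∈ classicalGroup N .complex, ∃ g, ∀ i j, unitaryCoord N i j g = M i j :=
    fun M hM => ⟨⟨M, hM⟩, fun i j => rfl⟩
  obtain ⟨e, he⟩ := exists_starAlgEquiv_continuousMap (unitaryCoord N) hmem hinj hsurj
  refine ⟨e, fun i j g => ?_⟩
  rw [he]
  rfl

end Gelfand

end LiberatedQG

end

theorem proposition3p5 (N : ℕ) :
    -- the diagram of quantum groups, with all its inclusions being proper for `N ≥ 3`
    (∃ h : ∀ X : LiberatedQG.Label, LiberatedQG.HopfMaps X N,
      ∀ X Y : LiberatedQG.Label, LiberatedQG.Arrow X Y →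
        ∃ p : LiberatedQG.Fun Y N →⋆ₐ[ℂ] LiberatedQG.Fun X N,
          LiberatedQG.IsInclusion (h X) (h Y) p ∧ (3 ≤ N → ¬ Function.Injective p)) ∧
    -- the quantum groups at left are the usual compact groups `O_N` and `U_N`
    (∃ e : LiberatedQG.Fun ⟨.real, .classical⟩ N ≃⋆ₐ[ℂ] C(Matrix.orthogonalGroup (Fin N) ℝ, ℂ),
      ∀ i j g, e (LiberatedQG.coord ⟨.real, .classical⟩ N i j) g = ((g : Matrix _ _ ℝ) i j : ℂ)) ∧
    (∃ e : LiberatedQG.Fun ⟨.complex, .classical⟩ N ≃⋆ₐ[ℂ] C(Matrix.unitaryGroup (Fin N) ℂ, ℂ),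
      ∀ i j g, e (LiberatedQG.coord ⟨.complex, .classical⟩ N i j) g = (g : Matrix _ _ ℂ) i j) ∧
    -- the diagram of the classical versions
    ∀ X : LiberatedQG.Label,
      LiberatedQG.classicalVersion X N = LiberatedQG.classicalTable N X := by
  -- Choosing the Hopf maps arbitrarily is harmless, since their values on coordinates determine
  -- them.
  refine ⟨⟨fun X => (LiberatedQG.exists_hopfMaps X N).some, fun X Y h => ?_⟩,
    LiberatedQG.exists_starAlgEquiv_orthogonalGroup N,
    LiberatedQG.exists_starAlgEquiv_unitaryGroup N,
    fun X => LiberatedQG.classicalVersion_eq_classicalTable X N⟩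
  obtain ⟨p, hp⟩ := LiberatedQG.exists_lift_fun (h.relations (LiberatedQG.relations_coord X N))
  exact ⟨p, LiberatedQG.isInclusion_of_map_coord _ _ p hp, fun hN => h.not_injective hN hp⟩
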